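/- Let $G$ be a finite simple maximal planar graph (a triangulation), i.e. $G$ is planar and adding an edge between any two distinct non-adjacent vertices destroys planarity, and suppose that $G$ has more than $3$ vertices. For a crossing-free straight-line drawing $\pi$ of $G$ in the plane, let $\mathrm{cut}(G,\pi)$ be the maximum number of collinear points in the plane such that each of them is an inner point of some face of $\pi$ (the unbounded face included) and no two of them lie in the same face, and let $\mathrm{cut}(G)=\max_\pi \mathrm{cut}(G,\pi)$ over all such drawings $\pi$. Let $G^*$ be the dual graph of $G$: its vertices are the faces of a crossing-free straight-line drawing of $G$, and two distinct faces are adjacent iff they share a common edge of $G$. For any drawing chosen to form $G^*$, $$\mathrm{cut}(G)\le c(G^*),$$ where the circumference $c(G^*)$ is the length of a longest cycle in $G^*$. -/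

import Mathlib

/-- The Euclidean plane. -/
abbrev Plane : Type := EuclideanSpace ℝ (Fin 2)

/-- A topological plane embedding of a simple graph: vertices are distinct points, each edge is a
simple arc joining the points of its end vertices, an arc passes through no vertex other than its
ends, and two distinct arcs meet only in the points of common end vertices. -/
structure PlaneEmbedding {V : Type*} (G : SimpleGraph V) where
  pos : V → Plane
  arc : Sym2 V → Set Plane
  pos_injective : Function.Injective pos
  arc_simple : ∀ u v : V, G.Adj u v →
    ∃ γ : Path (pos u) (pos v), Function.Injective γ ∧ Set.range γ = arc s(u, v)
  mem_of_pos_mem_arc : ∀ e ∈ G.edgeSet, ∀ w : V, pos w ∈ arc e → w ∈ e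
  arc_inter_arc : ∀ e ∈ G.edgeSet, ∀ f ∈ G.edgeSet, e ≠ f →
    arc e ∩ arc f ⊆ pos '' {w : V | w ∈ e ∧ w ∈ f}

/-- A graph is planar if it has a plane embedding. -/
def IsPlanarGraph {V : Type*} (G : SimpleGraph V) : Prop :=
  Nonempty (PlaneEmbedding G)

/-- A maximal planar graph: it is planar, and joining any two distinct non-adjacent vertices by
a new edge violates planarity. -/
def IsMaximalPlanar {V : Type*} (G : SimpleGraph V) : Prop :=
  IsPlanarGraph G ∧
    ∀ u v : V, u ≠ v → ¬ G.Adj u v → ¬ IsPlanarGraph (G ⊔ SimpleGraph.edge u v)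

/-- A crossing-free straight-line drawing of a graph: vertices are distinct points, each edge is
drawn as the segment between its ends, this segment passes through no other vertex, and the
segments of two distinct edges meet only in common end vertices. -/
structure StraightLineDrawing {V : Type*} (G : SimpleGraph V) where
  pos : V → Plane
  pos_injective : Function.Injective pos
  eq_or_eq_of_pos_mem_segment : ∀ u v w : V, G.Adj u v →
    pos w ∈ segment ℝ (pos u) (pos v) → w = u ∨ w = v
  segment_inter_segment : ∀ u v x y : V, G.Adj u v → G.Adj x y → s(u, v) ≠ s(x, y) →
    segment ℝ (pos u) (pos v) ∩ segment ℝ (pos x) (pos y) ⊆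
      pos '' (({u, v} : Set V) ∩ {x, y})

namespace StraightLineDrawing

/-- The set of all points of the plane covered by the drawing. -/
def support {V : Type*} {G : SimpleGraph V} (π : StraightLineDrawing G) : Set Plane :=
  Set.range π.pos ∪ {p : Plane | ∃ u v : V, G.Adj u v ∧ p ∈ segment ℝ (π.pos u) (π.pos v)}

/-- The faces of the drawing, bounded or not: the connected components of the complement of the
drawing. (They are open, so every point of a face is an inner point of it.) -/
def faces {V : Type*} {G : SimpleGraph V} (π : StraightLineDrawing G) : Set (Set Plane) :=
  {F | ∃ p ∈ π.supportᶜ, F = connectedComponentIn π.supportᶜ p}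

/-- The dual graph: its vertices are the faces, and two distinct faces are adjacent iff some edge
of the graph lies on the boundary of both. -/
def dual {V : Type*} {G : SimpleGraph V} (π : StraightLineDrawing G) :
    SimpleGraph π.faces where
  Adj F F' := F ≠ F' ∧ ∃ u v : V, G.Adj u v ∧
    segment ℝ (π.pos u) (π.pos v) ⊆ frontier (F : Set Plane) ∧
    segment ℝ (π.pos u) (π.pos v) ⊆ frontier (F' : Set Plane)
  symm := ⟨fun _ _ ⟨hne, u, v, huv, h₁, h₂⟩ => ⟨hne.symm, u, v, huv, h₂, h₁⟩⟩
  loopless := ⟨fun _ h => h.1 rfl⟩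

/-- A set of collinear points, each of them an inner point of some face, no two of them in the
same face. -/
def IsCutSet {V : Type*} {G : SimpleGraph V} (π : StraightLineDrawing G) (S : Set Plane) : Prop :=
  Collinear ℝ S ∧ (∀ p ∈ S, ∃ F ∈ π.faces, p ∈ F) ∧
    ∀ F ∈ π.faces, ∀ p ∈ S, ∀ q ∈ S, p ∈ F → q ∈ F → p = q

/-- `cut(G, π)`: the maximum size of a set of collinear points that are inner points of pairwise
distinct faces of `π`. -/
noncomputable def cut {V : Type*} {G : SimpleGraph V} (π : StraightLineDrawing G) : ℕ∞ :=
  ⨆ (S : Set Plane) (_ : π.IsCutSet S), S.encard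

end StraightLineDrawing

/-- `cut(G)`: the maximum of `cut(G, π)` over all crossing-free straight-line drawings `π`. -/
noncomputable def cutNumber {V : Type*} (G : SimpleGraph V) : ℕ∞ :=
  ⨆ π : StraightLineDrawing G, π.cut

/-- The circumference of a graph: the length of a longest cycle. -/
noncomputable def circumference {W : Type*} (H : SimpleGraph W) : ℕ∞ :=
  ⨆ (a : W) (c : H.Walk a a) (_ : c.IsCycle), (c.length : ℕ∞)

/-! Let `S` be a set of collinear points in distinct faces of a drawing `π`. Faces are open, so the
line can be shifted slightly until it misses every vertex while still meeting the same faces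
(`eventually_line_avoids`). The shifted line comes from the outer face, crosses bounded faces one
after another and returns to the outer face. A bounded face is an open triangle, hence convex, so it
is met in a single stretch; both unbounded rays lie in the outer face. The faces met therefore form
a cyclic sequence without repetition in which neighbours share the crossed edge
(`exists_cyclic_faces`). There are at least three of them, because two distinct facial triangles
share at most one edge and the line crosses an edge at most once. This is a cycle of length at least
`|S|` in the dual of `π`.

The dual in the theorem comes from another drawing `ρ`. A vertex triple that bounds a face of `π`
also bounds one of `ρ`: a facial triangle does not separate the graph (`FaceOf.not_separating`),
whereas a triangle of `ρ` with vertices both inside and outside would separate it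
(`FaceOf.transfer`). So the cycle carries over to `ρ` (`le_circumference_dual`).

All this rests on the faces being triangles. Maximality enters only through `adj_of_path`: vertices
joined by a path with one bend that avoids the drawing are adjacent. Since planarity is defined by
arcs, the new edge may be bent. It follows that the convex hull is a triangle
(`exists_outer_triangle`), that neighbours consecutive around a vertex at an angle below a half-turn
span an empty triangle (`isEmptyTri_of_sector`), and that such triangles cover the points of the
hull off the drawing (`exists_isEmptyTri`). -/

/-! ### Plane geometry: orientation, triangles, segments and bent paths. -/

/-- Twice the signed area of the triangle `a b c`. -/
def orient (a b c : Plane) : ℝ := (b 0 - a 0) * (c 1 - a 1) - (b 1 - a 1) * (c 0 - a 0)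

/-- The closed triangle with counterclockwise corners `a b c`, as an intersection of half-planes. -/
def closedTri (a b c : Plane) : Set Plane :=
  {p | 0 ≤ orient a b p ∧ 0 ≤ orient b c p ∧ 0 ≤ orient c a p}

/-- The open triangle with counterclockwise corners `a b c`. -/
def openTri (a b c : Plane) : Set Plane :=
  {p | 0 < orient a b p ∧ 0 < orient b c p ∧ 0 < orient c a p}

theorem plane_ext {p q : Plane} (h0 : p 0 = q 0) (h1 : p 1 = q 1) : p = q := by
  ext i; fin_cases i <;> assumption

theorem orient_rotate (a b c : Plane) : orient b c a = orient a b c := by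
  unfold orient; ring

theorem orient_swap (a b c : Plane) : orient a c b = -orient a b c := by
  unfold orient; ring

theorem orient_swap' (a b c : Plane) : orient b a c = -orient a b c := by
  unfold orient; ring

@[simp] theorem orient_self_left (a b : Plane) : orient a b a = 0 := by unfold orient; ring
@[simp] theorem orient_self_right (a b : Plane) : orient a b b = 0 := by unfold orient; ring
@[simp] theorem orient_self (a b : Plane) : orient a a b = 0 := by unfold orient; ring

theorem orient_sum (a b c p : Plane) :
    orient a b p + orient b c p + orient c a p = orient a b c := by
  unfold orient; ring

/-- `orient x y` is affine in its last argument, and the three areas at `p` are its barycentric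
coordinates scaled by `orient a b c`. -/
theorem orient_bary (a b c x y p : Plane) :
    orient a b c * orient x y p =
      orient b c p * orient x y a + orient c a p * orient x y b + orient a b p * orient x y c := by
  unfold orient; ring

theorem mem_segment_iff {a b p : Plane} :
    p ∈ segment ℝ a b ↔ ∃ t : ℝ, 0 ≤ t ∧ t ≤ 1 ∧ p = (1 - t) • a + t • b := by
  constructor
  · rintro ⟨s, t, hs, ht, hst, rfl⟩
    exact ⟨t, ht, by linarith, by rw [← hst]; simp⟩
  · rintro ⟨t, h0, h1, rfl⟩
    exact ⟨1 - t, t, by linarith, h0, by ring, rfl⟩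

theorem mem_openSegment_iff {a b p : Plane} :
    p ∈ openSegment ℝ a b ↔ ∃ t : ℝ, 0 < t ∧ t < 1 ∧ p = (1 - t) • a + t • b := by
  constructor
  · rintro ⟨s, t, hs, ht, hst, rfl⟩
    exact ⟨t, ht, by linarith, by rw [← hst]; simp⟩
  · rintro ⟨t, h0, h1, rfl⟩
    exact ⟨1 - t, t, by linarith, h0, by ring, rfl⟩

theorem orient_comb (x y a b : Plane) (t : ℝ) :
    orient x y ((1 - t) • a + t • b) = (1 - t) * orient x y a + t * orient x y b := by
  simp only [orient, PiLp.add_apply, PiLp.smul_apply, smul_eq_mul]; ring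

theorem continuous_orient (x y : Plane) : Continuous (fun p => orient x y p) := by
  unfold orient; fun_prop

theorem convex_orient_nonneg (x y : Plane) : Convex ℝ {p | 0 ≤ orient x y p} := by
  intro a ha b hb s t hs ht hst
  obtain rfl : s = 1 - t := by linarith
  simp only [Set.mem_ofPred_eq, orient_comb] at *
  positivity

theorem convex_orient_pos (x y : Plane) : Convex ℝ {p | 0 < orient x y p} := by
  intro a ha b hb s t hs ht hst
  obtain rfl : s = 1 - t := by linarith
  simp only [Set.mem_ofPred_eq, orient_comb] at *
  rcases eq_or_lt_of_le ht with rfl | ht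
  · simpa using ha
  · have := mul_pos ht hb
    have := mul_nonneg hs ha.le
    linarith

theorem convex_closedTri (a b c : Plane) : Convex ℝ (closedTri a b c) :=
  (convex_orient_nonneg a b).inter ((convex_orient_nonneg b c).inter (convex_orient_nonneg c a))

theorem convex_openTri (a b c : Plane) : Convex ℝ (openTri a b c) :=
  (convex_orient_pos a b).inter ((convex_orient_pos b c).inter (convex_orient_pos c a))

theorem isClosed_closedTri (a b c : Plane) : IsClosed (closedTri a b c) :=
  (isClosed_le continuous_const (continuous_orient a b)).inter
    ((isClosed_le continuous_const (continuous_orient b c)).inter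
      (isClosed_le continuous_const (continuous_orient c a)))

theorem isOpen_openTri (a b c : Plane) : IsOpen (openTri a b c) :=
  (isOpen_lt continuous_const (continuous_orient a b)).inter
    ((isOpen_lt continuous_const (continuous_orient b c)).inter
      (isOpen_lt continuous_const (continuous_orient c a)))

theorem openTri_subset_closedTri (a b c : Plane) : openTri a b c ⊆ closedTri a b c :=
  fun _ h => ⟨h.1.le, h.2.1.le, h.2.2.le⟩

theorem closedTri_rotate (a b c : Plane) : closedTri b c a = closedTri a b c := by
  ext p; simp only [closedTri, Set.mem_ofPred_eq]; tauto

theorem left_mem_closedTri {a b c : Plane} (h : 0 < orient a b c) : a ∈ closedTri a b c := by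
  refine ⟨by simp, ?_, by simp⟩
  rw [orient_rotate]; exact h.le

theorem mid_mem_closedTri {a b c : Plane} (h : 0 < orient a b c) : b ∈ closedTri a b c := by
  rw [← closedTri_rotate]; exact left_mem_closedTri (by rwa [orient_rotate])

theorem right_mem_closedTri {a b c : Plane} (h : 0 < orient a b c) : c ∈ closedTri a b c := by
  rw [← closedTri_rotate]; exact mid_mem_closedTri (by rwa [orient_rotate])

theorem mem_segment_of_orient {a b c p : Plane} (h : 0 < orient a b c) (h0 : orient a b p = 0)
    (h1 : 0 ≤ orient b c p) (h2 : 0 ≤ orient c a p) : p ∈ segment ℝ a b := by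
  have hs := orient_sum a b c p
  refine ⟨orient b c p / orient a b c, orient c a p / orient a b c, by positivity, by positivity,
    ?_, ?_⟩
  · field_simp; linarith
  · have hne := h.ne'
    apply plane_ext <;> simp only [PiLp.add_apply, PiLp.smul_apply, smul_eq_mul] <;> field_simp <;>
      unfold orient at *
    · linear_combination -(c 0) * h0
    · linear_combination -(c 1) * h0

theorem segment_subset_closedTri {a b c u v : Plane} (hu : u ∈ closedTri a b c)
    (hv : v ∈ closedTri a b c) : segment ℝ u v ⊆ closedTri a b c :=
  (convex_closedTri a b c).segment_subset hu hv

/-- A point of a closed triangle that is not interior lies on a side. -/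
theorem mem_side_of_mem_closedTri {a b c p : Plane} (h : 0 < orient a b c)
    (hp : p ∈ closedTri a b c) (hp' : p ∉ openTri a b c) :
    p ∈ segment ℝ a b ∨ p ∈ segment ℝ b c ∨ p ∈ segment ℝ c a := by
  obtain ⟨h1, h2, h3⟩ := hp
  by_cases e1 : orient a b p = 0
  · exact Or.inl (mem_segment_of_orient h e1 h2 h3)
  by_cases e2 : orient b c p = 0
  · exact Or.inr (Or.inl (mem_segment_of_orient (by rwa [orient_rotate]) e2 h3 h1))
  by_cases e3 : orient c a p = 0
  · exact Or.inr (Or.inr (mem_segment_of_orient (by rwa [orient_rotate, orient_rotate]) e3 h1 h2))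
  exact absurd ⟨lt_of_le_of_ne h1 (Ne.symm e1), lt_of_le_of_ne h2 (Ne.symm e2),
    lt_of_le_of_ne h3 (Ne.symm e3)⟩ hp'

theorem orient_eq_zero_of_mem_segment {a b p : Plane} (h : p ∈ segment ℝ a b) :
    orient a b p = 0 := by
  obtain ⟨t, -, -, rfl⟩ := mem_segment_iff.1 h
  simp [orient_comb]

/-- A segment from a point of `K` to a point outside the open set `U ⊆ K` leaves `U` in a point
of `K`, if `K` is closed. -/
theorem exists_exit {U K : Set Plane} (hU : IsOpen U) (hK : IsClosed K) (hUK : U ⊆ K)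
    {q z : Plane} (hq : q ∈ U) (hz : z ∉ U) : ∃ y ∈ segment ℝ q z, y ∈ K ∧ y ∉ U := by
  by_contra! hcon
  have hpre := (convex_segment (𝕜 := ℝ) q z).isPreconnected
  obtain ⟨y, hy, hyU, hyK⟩ := hpre U Kᶜ hU hK.isOpen_compl
    (fun y hy => by
      by_cases hyU : y ∈ U
      · exact Or.inl hyU
      · exact Or.inr fun hyK => hyU (hcon y hy hyK))
    ⟨q, left_mem_segment ℝ q z, hq⟩
    ⟨z, right_mem_segment ℝ q z, fun hzK => hz (hcon z (right_mem_segment ℝ q z) hzK)⟩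
  exact hyK (hUK hyU)

theorem exists_exit_tri {a b c q z : Plane} (hq : q ∈ openTri a b c) (hz : z ∉ openTri a b c) :
    ∃ y ∈ segment ℝ q z, y ∈ closedTri a b c ∧ y ∉ openTri a b c :=
  exists_exit (isOpen_openTri a b c) (isClosed_closedTri a b c) (openTri_subset_closedTri a b c)
    hq hz

/-- This locates the point where an edge leaves a sector; `φ` and `ψ` will be the orientation
functions of the two bounding lines. -/
theorem exists_exit_wedge {φ ψ : Plane → ℝ} (hφ : Continuous φ) (hψ : Continuous ψ) {q z : Plane}
    (hq1 : 0 < φ q) (hq2 : 0 < ψ q) (hz : ¬(0 ≤ φ z ∧ 0 ≤ ψ z)) :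
    ∃ y ∈ segment ℝ q z, 0 ≤ φ y ∧ 0 ≤ ψ y ∧ (φ y = 0 ∨ ψ y = 0) := by
  obtain ⟨y, hy, ⟨h1, h2⟩, hyU⟩ := exists_exit
    (U := {p | 0 < φ p} ∩ {p | 0 < ψ p}) (K := {p | 0 ≤ φ p} ∩ {p | 0 ≤ ψ p})
    ((isOpen_lt continuous_const hφ).inter (isOpen_lt continuous_const hψ))
    ((isClosed_le continuous_const hφ).inter (isClosed_le continuous_const hψ))
    (fun y hy => ⟨le_of_lt (show 0 < φ y from hy.1), le_of_lt (show 0 < ψ y from hy.2)⟩) ⟨hq1, hq2⟩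
    (fun h => hz ⟨le_of_lt (show 0 < φ z from h.1), le_of_lt (show 0 < ψ z from h.2)⟩)
  refine ⟨y, hy, h1, h2, ?_⟩
  by_contra! hne
  exact hyU ⟨lt_of_le_of_ne h1 hne.1.symm, lt_of_le_of_ne h2 hne.2.symm⟩

/-- The complement is a union of three open half-planes, and two of them always meet beyond their
common corner. -/
theorem isPreconnected_compl_closedTri {a b c : Plane} (h : 0 < orient a b c) :
    IsPreconnected (closedTri a b c)ᶜ := by
  have hneg : ∀ x y : Plane, IsPreconnected {p | orient x y p < 0} := by
    intro x y
    have : {p | orient x y p < 0} = {p | 0 < orient y x p} := by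
      ext p; simp only [Set.mem_ofPred_eq, orient_swap' x y p]; constructor <;> intro h <;> linarith
    rw [this]; exact (convex_orient_pos y x).isPreconnected
  have key : ∀ x y z : Plane, 0 < orient x y z → ∃ q, orient x y q < 0 ∧ orient z x q < 0 := by
    intro x y z hxyz
    have h1 : orient z x y = orient x y z := by rw [orient_rotate, orient_rotate]
    -- The corner `x`, pushed away from the midpoint of the opposite side `yz`.
    refine ⟨(1 - 3 : ℝ) • ((1 - (1/2) : ℝ) • y + (1/2 : ℝ) • z) + (3 : ℝ) • x, ?_⟩
    simp only [orient_comb, orient_self_left, orient_self_right, h1]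
    constructor <;> linarith
  have hset : (closedTri a b c)ᶜ =
      ({p | orient a b p < 0} ∪ {p | orient b c p < 0}) ∪ {p | orient c a p < 0} := by
    ext p
    simp only [closedTri, Set.mem_compl_iff, Set.mem_ofPred_eq, Set.mem_union, not_and_or, not_le]
    tauto
  obtain ⟨q, hq1, hq2⟩ := key b c a (by rwa [orient_rotate])
  obtain ⟨r, hr1, hr2⟩ := key a b c h
  rw [hset]
  exact IsPreconnected.union r (Or.inl hr1) hr2
    (IsPreconnected.union q hq2 hq1 (hneg a b) (hneg b c)) (hneg c a)

theorem side_subset_closure_openTri {a b c p o : Plane} (ho : o ∈ openTri a b c)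
    (hp : p ∈ closedTri a b c) : p ∈ closure (openTri a b c) := by
  have hcont : Filter.Tendsto (fun t : ℝ => (1 - t) • p + t • o) (nhdsWithin 0 (Set.Ioi 0))
      (nhds p) := by
    have : Continuous (fun t : ℝ => (1 - t) • p + t • o) := by fun_prop
    have h2 := this.tendsto 0
    simp only [sub_zero, one_smul, zero_smul, add_zero] at h2
    exact h2.mono_left nhdsWithin_le_nhds
  refine mem_closure_of_tendsto hcont ?_
  have h1 : Set.Ioo (0 : ℝ) 1 ∈ nhdsWithin 0 (Set.Ioi (0 : ℝ)) := Ioo_mem_nhdsGT one_pos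
  filter_upwards [h1] with t ht
  have aux : ∀ x y : Plane, 0 ≤ orient x y p → 0 < orient x y o →
      0 < orient x y ((1 - t) • p + t • o) := by
    intro x y h1 h2
    rw [orient_comb]
    have := mul_pos ht.1 h2
    have := mul_nonneg (sub_nonneg.2 ht.2.le) h1
    linarith
  exact ⟨aux _ _ hp.1 ho.1, aux _ _ hp.2.1 ho.2.1, aux _ _ hp.2.2 ho.2.2⟩

/-- Points of the line `pc` at negative parameters lie across the side `ab` from `c`, and they tend
to `p`. -/
theorem side_subset_closure_compl {a b c p : Plane} (h : 0 < orient a b c)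
    (hp : p ∈ segment ℝ a b) : p ∈ closure (closedTri a b c)ᶜ := by
  have hp0 := orient_eq_zero_of_mem_segment hp
  have hcont : Filter.Tendsto (fun t : ℝ => (1 - t) • p + t • c) (nhdsWithin 0 (Set.Iio 0))
      (nhds p) := by
    have : Continuous (fun t : ℝ => (1 - t) • p + t • c) := by fun_prop
    have h2 := this.tendsto 0
    simp only [sub_zero, one_smul, zero_smul, add_zero] at h2
    exact h2.mono_left nhdsWithin_le_nhds
  refine mem_closure_of_tendsto hcont ?_
  filter_upwards [self_mem_nhdsWithin] with t ht hmem
  have h1 := hmem.1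
  rw [orient_comb, hp0] at h1
  have := mul_neg_of_neg_of_pos (show t < 0 from ht) h
  linarith

theorem exists_mem_openTri {a b c : Plane} (h : 0 < orient a b c) : (openTri a b c).Nonempty := by
  have h1 : orient b c a = orient a b c := orient_rotate a b c
  have h2 : orient c a b = orient a b c := by rw [orient_rotate, orient_rotate]
  refine ⟨(1 - (1/2) : ℝ) • ((1 - (1/2) : ℝ) • a + (1/2 : ℝ) • b) + (1/2 : ℝ) • c, ?_, ?_, ?_⟩ <;>
    simp only [orient_comb, orient_self_left, orient_self_right, h1, h2] <;> linarith

/-- Crossing criterion for two segments. -/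
theorem segments_meet {a b c d : Plane} (h1 : orient a b c < 0) (h2 : 0 < orient a b d)
    (h3 : 0 < orient c d a) (h4 : orient c d b < 0) :
    ∃ p, p ∈ segment ℝ a b ∧ p ∈ segment ℝ c d := by
  have hd : 0 < orient a b d - orient a b c := by linarith
  have he : orient c d a - orient c d b = orient a b d - orient a b c := by unfold orient; ring
  -- The parameter at which `orient c d` vanishes along `ab`. By `he` the parameter on `cd` has the
  -- same denominator.
  refine ⟨(1 - orient c d a / (orient a b d - orient a b c)) • a +
    (orient c d a / (orient a b d - orient a b c)) • b, ?_, ?_⟩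
  · refine mem_segment_iff.2 ⟨_, by positivity, ?_, rfl⟩
    rw [div_le_one hd]; linarith
  · refine mem_segment_iff.2 ⟨-orient a b c / (orient a b d - orient a b c),
      div_nonneg (by linarith) hd.le, ?_, ?_⟩
    · rw [div_le_one hd]; linarith
    · apply plane_ext <;> simp only [PiLp.add_apply, PiLp.smul_apply, smul_eq_mul] <;> field_simp <;>
        unfold orient <;> ring

/-- Among finitely many points strictly on one side of the ray from `p` towards `x`, one comes
first in the angular order around `p`. -/
theorem exists_angular_min {ι : Type*} (W : Finset ι) (hW : W.Nonempty) (f : ι → Plane)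
    (p x : Plane) (σ : ℝ) (hpos : ∀ w ∈ W, 0 < σ * orient p x (f w)) :
    ∃ w ∈ W, ∀ z ∈ W, 0 ≤ σ * orient p (f w) (f z) := by
  let dot : Plane → ℝ := fun w => (x 0 - p 0) * (w 0 - p 0) + (x 1 - p 1) * (w 1 - p 1)
  -- Up to a positive constant factor the quotient is the cotangent of the angle at `p` from `x` to
  -- `w`, so its maximum gives the least angle.
  obtain ⟨w, hw, hmax⟩ := Finset.exists_max_image W (fun w => dot (f w) / (σ * orient p x (f w))) hW
  refine ⟨w, hw, fun z hz => ?_⟩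
  have h1 := hmax z hz
  rw [div_le_div_iff₀ (hpos z hz) (hpos w hw)] at h1
  have hx : 0 < (x 0 - p 0) ^ 2 + (x 1 - p 1) ^ 2 := by
    by_contra hcon
    have h0 : (x 0 - p 0) = 0 := by nlinarith [sq_nonneg (x 0 - p 0), sq_nonneg (x 1 - p 1)]
    have h1 : (x 1 - p 1) = 0 := by nlinarith [sq_nonneg (x 0 - p 0), sq_nonneg (x 1 - p 1)]
    have := hpos w hw
    simp [orient, h0, h1] at this
  have hid : ((x 0 - p 0) ^ 2 + (x 1 - p 1) ^ 2) * (σ * orient p (f w) (f z)) =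
      dot (f w) * (σ * orient p x (f z)) - dot (f z) * (σ * orient p x (f w)) := by
    simp only [orient, dot]; ring
  have : 0 ≤ ((x 0 - p 0) ^ 2 + (x 1 - p 1) ^ 2) * (σ * orient p (f w) (f z)) := by
    rw [hid]; linarith
  exact nonneg_of_mul_nonneg_right this hx

theorem bary_point (a b c p : Plane) :
    orient a b c • p = orient b c p • a + orient c a p • b + orient a b p • c := by
  apply plane_ext <;> simp only [PiLp.add_apply, PiLp.smul_apply, smul_eq_mul] <;>
    unfold orient <;> ring

theorem exists_orient_pos {x y : Plane} (hxy : x ≠ y) : ∃ q, 0 < orient x y q := by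
  -- The vector `y - x` turned by a quarter turn and attached at `x`; the area is then the squared
  -- length of `y - x`.
  refine ⟨!₂[x 0 - (y 1 - x 1), x 1 + (y 0 - x 0)], ?_⟩
  simp only [orient, Matrix.cons_val_zero, Matrix.cons_val_one]
  by_contra hcon
  refine hxy (plane_ext ?_ ?_) <;>
    nlinarith [sq_nonneg (y 1 - x 1), sq_nonneg (y 0 - x 0)]

theorem exists_comb_of_orient_eq_zero {x y w : Plane} (hne : x ≠ y) (h0 : orient x y w = 0) :
    ∃ s : ℝ, w = (1 - s) • x + s • y := by
  obtain ⟨q, hq⟩ := exists_orient_pos hne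
  have hb := bary_point x y q w
  have hs := orient_sum x y q w
  rw [h0, zero_smul, add_zero] at hb
  rw [h0, zero_add] at hs
  refine ⟨orient q x w / orient x y q, ?_⟩
  rw [← sub_eq_zero, ← smul_right_inj hq.ne', smul_zero, smul_sub, hb, smul_add, smul_smul,
    smul_smul, mul_sub, mul_div_cancel₀ _ hq.ne', mul_one, ← hs]
  module

/-- The factor `σ` carries the sign of the orientation, so that mirror-image configurations need
only one argument. -/
theorem mem_segment_of_orient_smul {σ : ℝ} {a b c p : Plane} (h : 0 < σ * orient a b c)
    (h0 : σ * orient a b p = 0) (h1 : 0 ≤ σ * orient b c p) (h2 : 0 ≤ σ * orient c a p) :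
    p ∈ segment ℝ a b := by
  have hσ : σ ≠ 0 := by rintro rfl; simp at h
  have hs := orient_sum a b c p
  have hb := bary_point a b c p
  have h0' : orient a b p = 0 := (mul_eq_zero.1 h0).resolve_left hσ
  rw [h0', zero_smul, add_zero] at hb
  have hne : orient a b c ≠ 0 := by rintro h'; simp [h'] at h
  refine ⟨(σ * orient b c p) / (σ * orient a b c), (σ * orient c a p) / (σ * orient a b c),
    by positivity, by positivity, ?_, ?_⟩
  · rw [← add_div, ← mul_add, ← hs, h0', zero_add, div_self]
    rw [h0', zero_add] at hs
    rw [hs]; exact h.ne'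
  · rw [mul_div_mul_left _ _ hσ, mul_div_mul_left _ _ hσ, ← smul_right_inj hne, hb, smul_add,
      smul_smul, smul_smul, mul_div_cancel₀ _ hne, mul_div_cancel₀ _ hne]

theorem exists_straight_path {a b : Plane} (hab : a ≠ b) :
    ∃ γ : Path a b, Function.Injective γ ∧ Set.range γ = segment ℝ a b := by
  refine ⟨⟨⟨fun t => (1 - (t : ℝ)) • a + (t : ℝ) • b, by fun_prop⟩, by simp, by simp⟩, ?_, ?_⟩
  · intro t s hts
    have h : (1 - (t : ℝ)) • a + (t : ℝ) • b = (1 - (s : ℝ)) • a + (s : ℝ) • b := hts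
    have h2 : ((t : ℝ) - s) • (b - a) = 0 := by
      have : ((t : ℝ) - s) • (b - a) = ((1 - (t : ℝ)) • a + (t : ℝ) • b) -
        ((1 - (s : ℝ)) • a + (s : ℝ) • b) := by module
      rw [this, h, sub_self]
    rcases smul_eq_zero.1 h2 with h3 | h3
    · exact Subtype.ext (by linarith)
    · exact absurd (sub_eq_zero.1 h3).symm hab
  · ext p
    rw [mem_segment_iff]
    constructor
    · rintro ⟨t, rfl⟩
      exact ⟨t, t.2.1, t.2.2, rfl⟩
    · rintro ⟨t, h0, h1, rfl⟩
      exact ⟨⟨t, h0, h1⟩, rfl⟩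

/-- The path adds to the straight parametrisation the hat function `min t (1 - t)` times `2q - a -
b`, so it reaches `q` at `t = 1/2`. The cross product with `2q - a - b` removes the hat term and
leaves a function of `t` with slope a nonzero multiple of `orient a b q`, which gives injectivity.
If `q` is the midpoint, the path is straight. -/
theorem exists_bent_path {a b q : Plane} (hab : a ≠ b)
    (hq : orient a b q ≠ 0 ∨ q = (1 / 2 : ℝ) • a + (1 / 2 : ℝ) • b) :
    ∃ γ : Path a b, Function.Injective γ ∧ Set.range γ = segment ℝ a q ∪ segment ℝ q b := by
  have hlow : ∀ t : ℝ, t ≤ 1 / 2 → (1 - t) • a + t • b + (min t (1 - t)) • ((2 : ℝ) • q - a - b) =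
      (1 - 2 * t) • a + (2 * t) • q := by
    intro t ht
    rw [min_eq_left (by linarith)]; module
  have hhigh : ∀ t : ℝ, 1 / 2 ≤ t → (1 - t) • a + t • b + (min t (1 - t)) • ((2 : ℝ) • q - a - b) =
      (1 - (2 * t - 1)) • q + (2 * t - 1) • b := by
    intro t ht
    rw [min_eq_right (by linarith)]; module
  refine ⟨⟨⟨fun t => (1 - (t : ℝ)) • a + (t : ℝ) • b +
    (min (t : ℝ) (1 - t)) • ((2 : ℝ) • q - a - b), by fun_prop⟩, by simp, by simp⟩, ?_, ?_⟩
  · intro t s hts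
    have h : (1 - (t : ℝ)) • a + (t : ℝ) • b + (min (t : ℝ) (1 - t)) • ((2 : ℝ) • q - a - b) =
      (1 - (s : ℝ)) • a + (s : ℝ) • b + (min (s : ℝ) (1 - s)) • ((2 : ℝ) • q - a - b) := hts
    rcases hq with hq | hq
    · have e0 := congrArg (fun p : Plane => p 0) h
      have e1 := congrArg (fun p : Plane => p 1) h
      simp only [PiLp.add_apply, PiLp.smul_apply, PiLp.sub_apply, smul_eq_mul] at e0 e1
      have h2 : ((t : ℝ) - s) * orient a b q = 0 := by
        unfold orient
        linear_combination (2 * q 1 - a 1 - b 1) / 2 * e0 - (2 * q 0 - a 0 - b 0) / 2 * e1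
      rcases mul_eq_zero.1 h2 with h3 | h3
      · exact Subtype.ext (by linarith)
      · exact absurd h3 hq
    · have h0 : (2 : ℝ) • q - a - b = 0 := by rw [hq]; module
      rw [h0, smul_zero, smul_zero, add_zero, add_zero] at h
      have h2 : ((t : ℝ) - s) • (b - a) = 0 := by
        have : ((t : ℝ) - s) • (b - a) = ((1 - (t : ℝ)) • a + (t : ℝ) • b) -
          ((1 - (s : ℝ)) • a + (s : ℝ) • b) := by module
        rw [this, h, sub_self]
      rcases smul_eq_zero.1 h2 with h3 | h3
      · exact Subtype.ext (by linarith)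
      · exact absurd (sub_eq_zero.1 h3).symm hab
  · ext p
    simp only [Set.mem_union, mem_segment_iff]
    constructor
    · rintro ⟨t, rfl⟩
      have ht0 := t.2.1
      have ht1 := t.2.2
      rcases le_total (t : ℝ) (1 / 2) with ht | ht
      · exact Or.inl ⟨2 * t, by linarith, by linarith, hlow t ht⟩
      · exact Or.inr ⟨2 * t - 1, by linarith, by linarith, hhigh t ht⟩
    · rintro (⟨t, h0, h1, rfl⟩ | ⟨t, h0, h1, rfl⟩)
      · refine ⟨⟨t / 2, by linarith, by linarith⟩, (hlow (t / 2) (by linarith)).trans ?_⟩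
        congr 2 <;> ring
      · refine ⟨⟨(t + 1) / 2, by linarith, by linarith⟩,
          (hhigh ((t + 1) / 2) (by linarith)).trans ?_⟩
        congr 2 <;> ring

/-! ### Consequences of maximality, and the outer triangle. -/

namespace StraightLineDrawing

variable {V : Type*} {G : SimpleGraph V} (π : StraightLineDrawing G)

theorem pos_mem_support (w : V) : π.pos w ∈ π.support := Or.inl ⟨w, rfl⟩

theorem segment_subset_support {u v : V} (h : G.Adj u v) :
    segment ℝ (π.pos u) (π.pos v) ⊆ π.support := fun _ hp => Or.inr ⟨u, v, h, hp⟩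

/-- In a straight-line drawing of a maximal planar graph, two vertices are adjacent if they can be
joined by a path of two segments that avoids the drawing. -/
theorem adj_of_path (hG : IsMaximalPlanar G) {x y : V} (hxy : x ≠ y) (q : Plane)
    (hq : orient (π.pos x) (π.pos y) q ≠ 0 ∨
      q = (1 / 2 : ℝ) • π.pos x + (1 / 2 : ℝ) • π.pos y)
    (h1 : ∀ p ∈ segment ℝ (π.pos x) q, p ∈ π.support → p = π.pos x)
    (h2 : ∀ p ∈ segment ℝ q (π.pos y), p ∈ π.support → p = π.pos y) : G.Adj x y := by
  by_contra hn
  have hnew : ∀ p ∈ segment ℝ (π.pos x) q ∪ segment ℝ q (π.pos y), p ∈ π.support →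
      p = π.pos x ∨ p = π.pos y := fun p hp hs => hp.imp (fun h => h1 p h hs) (fun h => h2 p h hs)
  have hold : ∀ u v : V, G.Adj u v → s(u, v) ≠ s(x, y) := by
    intro u v huv he
    rw [← SimpleGraph.mem_edgeSet, he, SimpleGraph.mem_edgeSet] at huv
    exact hn huv
  -- Old edges keep their segments and `xy` receives the bent path. This embeds the graph with `xy`
  -- added, which maximality forbids.
  let arc : Sym2 V → Set Plane := fun e =>
    {p | (∃ u v, s(u, v) = e ∧ G.Adj u v ∧ p ∈ segment ℝ (π.pos u) (π.pos v)) ∨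
      (e = s(x, y) ∧ p ∈ segment ℝ (π.pos x) q ∪ segment ℝ q (π.pos y))}
  have arc_old : ∀ u v, G.Adj u v → arc s(u, v) = segment ℝ (π.pos u) (π.pos v) := by
    intro u v huv
    ext p
    constructor
    · rintro (⟨u', v', he, -, hp⟩ | ⟨he, -⟩)
      · rcases Sym2.eq_iff.1 he with ⟨rfl, rfl⟩ | ⟨rfl, rfl⟩
        · exact hp
        · rwa [segment_symm]
      · exact absurd he (hold u v huv)
    · exact fun hp => Or.inl ⟨u, v, rfl, huv, hp⟩
  have arc_new : arc s(x, y) = segment ℝ (π.pos x) q ∪ segment ℝ q (π.pos y) := by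
    ext p
    constructor
    · rintro (⟨u', v', he, h, -⟩ | ⟨-, hp⟩)
      · exact absurd he (hold u' v' h)
      · exact hp
    · exact fun hp => Or.inr ⟨rfl, hp⟩
  have hedge : ∀ e ∈ (G ⊔ SimpleGraph.edge x y).edgeSet,
      (∃ u v, G.Adj u v ∧ e = s(u, v)) ∨ e = s(x, y) := by
    intro e
    induction e using Sym2.ind with
    | _ u v =>
      rw [SimpleGraph.mem_edgeSet, SimpleGraph.sup_adj, SimpleGraph.edge_adj]
      rintro (h | ⟨⟨rfl, rfl⟩ | ⟨rfl, rfl⟩, -⟩)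
      · exact Or.inl ⟨u, v, h, rfl⟩
      · exact Or.inr rfl
      · exact Or.inr Sym2.eq_swap
  have hpath := exists_bent_path (π.pos_injective.ne hxy) hq
  refine hG.2 x y hxy hn ⟨⟨π.pos, arc, π.pos_injective, ?_, ?_, ?_⟩⟩
  · intro u v huv
    rw [SimpleGraph.sup_adj, SimpleGraph.edge_adj] at huv
    rcases huv with h | ⟨⟨rfl, rfl⟩ | ⟨rfl, rfl⟩, -⟩
    · rw [arc_old u v h]
      exact exists_straight_path (π.pos_injective.ne h.ne)
    · rw [arc_new]; exact hpath
    · obtain ⟨γ, hγ, hr⟩ := hpath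
      refine ⟨γ.symm, ?_, ?_⟩
      · exact hγ.comp unitInterval.symm_bijective.injective
      · rw [Path.symm_range, hr, Sym2.eq_swap, arc_new]
  · intro e he w hw
    rcases hedge e he with ⟨u, v, huv, rfl⟩ | rfl
    · rw [arc_old u v huv] at hw
      exact Sym2.mem_iff.2 (π.eq_or_eq_of_pos_mem_segment u v w huv hw)
    · rw [arc_new] at hw
      rcases hnew _ hw (π.pos_mem_support w) with h | h
      · exact Sym2.mem_iff.2 (Or.inl (π.pos_injective h))
      · exact Sym2.mem_iff.2 (Or.inr (π.pos_injective h))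
  · have mixed : ∀ u v, G.Adj u v → arc s(u, v) ∩ arc s(x, y) ⊆
        π.pos '' {w : V | w ∈ s(u, v) ∧ w ∈ s(x, y)} := by
      rintro u v huv p ⟨hp, hp'⟩
      rw [arc_old u v huv] at hp
      rw [arc_new] at hp'
      rcases hnew _ hp' (π.segment_subset_support huv hp) with rfl | rfl
      · exact ⟨x, ⟨Sym2.mem_iff.2 (π.eq_or_eq_of_pos_mem_segment u v x huv hp),
          Sym2.mem_mk_left _ _⟩, rfl⟩
      · exact ⟨y, ⟨Sym2.mem_iff.2 (π.eq_or_eq_of_pos_mem_segment u v y huv hp),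
          Sym2.mem_mk_right _ _⟩, rfl⟩
    intro e he f hf hne
    rcases hedge e he with ⟨u, v, huv, rfl⟩ | rfl
    · rcases hedge f hf with ⟨u', v', huv', rfl⟩ | rfl
      · rw [arc_old u v huv, arc_old u' v' huv']
        refine (π.segment_inter_segment u v u' v' huv huv' hne).trans (Set.image_mono ?_)
        intro w hw
        simpa using hw
      · exact mixed u v huv
    · rcases hedge f hf with ⟨u', v', huv', rfl⟩ | rfl
      · rw [Set.inter_comm]
        refine (mixed u' v' huv').trans (Set.image_mono ?_)
        exact fun w hw => ⟨hw.2, hw.1⟩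
      · exact absurd rfl hne

/-- Two distinct vertices that see each other are adjacent. -/
theorem adj_of_visible (hG : IsMaximalPlanar G) {x y : V} (hxy : x ≠ y)
    (h : ∀ p ∈ openSegment ℝ (π.pos x) (π.pos y), p ∉ π.support) : G.Adj x y := by
  refine π.adj_of_path hG hxy _ (Or.inr rfl) ?_ ?_
  · intro p hp hs
    obtain ⟨t, h0, h1, rfl⟩ := mem_segment_iff.1 hp
    rcases eq_or_lt_of_le h0 with rfl | h0
    · simp
    · exact absurd hs (h _ (mem_openSegment_iff.2 ⟨t / 2, by linarith, by linarith, by module⟩))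
  · intro p hp hs
    obtain ⟨t, h0, h1, rfl⟩ := mem_segment_iff.1 hp
    rcases eq_or_lt_of_le h1 with rfl | h1
    · simp
    · exact absurd hs (h _ (mem_openSegment_iff.2 ⟨(t + 1) / 2, by linarith, by linarith, by module⟩))

theorem orient_nonneg_of_mem_support {x y p : Plane} (h : ∀ w, 0 ≤ orient x y (π.pos w))
    (hp : p ∈ π.support) : 0 ≤ orient x y p := by
  rcases hp with ⟨w, rfl⟩ | ⟨u, v, -, hp⟩
  · exact h w
  · exact (convex_orient_nonneg x y).segment_subset (h u) (h v) hp

/-- The whole drawing lies on one side of the line `xy`, so a path with its bend on the other side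
meets it only in its ends. -/
theorem adj_of_hull (hG : IsMaximalPlanar G) {x y : V} (hxy : x ≠ y)
    (h : ∀ w, 0 ≤ orient (π.pos x) (π.pos y) (π.pos w)) : G.Adj x y := by
  obtain ⟨q, hq⟩ := exists_orient_pos (π.pos_injective.ne hxy.symm)
  rw [orient_swap', neg_pos] at hq
  refine π.adj_of_path hG hxy q (Or.inl hq.ne) ?_ ?_
  · intro p hp hs
    have hs := π.orient_nonneg_of_mem_support h hs
    obtain ⟨t, h0, h1, rfl⟩ := mem_segment_iff.1 hp
    rw [orient_comb, orient_self_left] at hs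
    have : t = 0 := by nlinarith
    simp [this]
  · intro p hp hs
    have hs := π.orient_nonneg_of_mem_support h hs
    obtain ⟨t, h0, h1, rfl⟩ := mem_segment_iff.1 hp
    rw [orient_comb, orient_self_right] at hs
    have : t = 1 := by nlinarith
    simp [this]

/-- If `w` lay on the line `xy`, then of the three collinear vertices the two extreme ones would be
adjacent by `adj_of_hull`, and their edge would pass through the third. -/
theorem orient_pos_of_hull (hG : IsMaximalPlanar G) {x y : V} (hxy : x ≠ y)
    (h : ∀ w, 0 ≤ orient (π.pos x) (π.pos y) (π.pos w)) {w : V} (hwx : w ≠ x) (hwy : w ≠ y) :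
    0 < orient (π.pos x) (π.pos y) (π.pos w) := by
  refine lt_of_le_of_ne (h w) fun h0 => ?_
  have hadj := π.adj_of_hull hG hxy h
  obtain ⟨s, hs⟩ := exists_comb_of_orient_eq_zero (π.pos_injective.ne hxy) h0.symm
  have hval : ∀ z, orient (π.pos x) (π.pos w) (π.pos z) =
      s * orient (π.pos x) (π.pos y) (π.pos z) := by
    intro z; rw [hs]; simp only [orient, PiLp.add_apply, PiLp.smul_apply, smul_eq_mul]; ring
  have hval' : ∀ z, orient (π.pos w) (π.pos y) (π.pos z) =
      (1 - s) * orient (π.pos x) (π.pos y) (π.pos z) := by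
    intro z; rw [hs]; simp only [orient, PiLp.add_apply, PiLp.smul_apply, smul_eq_mul]; ring
  rcases lt_or_ge s 0 with h1 | h1
  · have hwadj := π.adj_of_hull hG hwy fun z => by
      rw [hval']; exact mul_nonneg (by linarith) (h z)
    have hx : π.pos x = (1 - -s / (1 - s)) • π.pos w + (-s / (1 - s)) • π.pos y := by
      have : (1 : ℝ) - s ≠ 0 := by linarith
      rw [hs]; apply plane_ext <;> simp only [PiLp.add_apply, PiLp.smul_apply, smul_eq_mul] <;>
        field_simp <;> ring
    rcases π.eq_or_eq_of_pos_mem_segment w y x hwadj (mem_segment_iff.2 ⟨-s / (1 - s),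
      div_nonneg (by linarith) (by linarith), by rw [div_le_one] <;> linarith, hx⟩) with h | h
    · exact hwx h.symm
    · exact hxy h
  rcases le_or_gt s 1 with h2 | h2
  · rcases π.eq_or_eq_of_pos_mem_segment x y w hadj (mem_segment_iff.2 ⟨s, h1, h2, hs⟩) with h | h
    · exact hwx h
    · exact hwy h
  · have hwadj := π.adj_of_hull hG hwx.symm fun z => by
      rw [hval]; exact mul_nonneg (by linarith) (h z)
    have hy : π.pos y = (1 - 1 / s) • π.pos x + (1 / s) • π.pos w := by
      have : s ≠ 0 := by linarith
      rw [hs]; apply plane_ext <;> simp only [PiLp.add_apply, PiLp.smul_apply, smul_eq_mul] <;>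
        field_simp <;> ring
    rcases π.eq_or_eq_of_pos_mem_segment x w y hwadj (mem_segment_iff.2 ⟨1 / s,
      by positivity, by rw [div_le_one] <;> linarith, hy⟩) with h | h
    · exact hxy h.symm
    · exact hwy h.symm

/-- A gift-wrapping step: the ray from `p` through `y` is continued beyond `y` and turned
counterclockwise to the first vertex. The point `p` need not be a vertex, so a tangent line can
start the process. -/
theorem exists_next_hull [Fintype V] (p : Plane) (y : V)
    (hp : ∀ w, w ≠ y → π.pos w ≠ p → 0 < orient p (π.pos y) (π.pos w))
    (hex : ∃ w, w ≠ y ∧ π.pos w ≠ p) :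
    ∃ z, z ≠ y ∧ π.pos z ≠ p ∧ ∀ w, 0 ≤ orient (π.pos y) (π.pos z) (π.pos w) := by
  classical
  -- The reflection of `p` in `y` marks the direction of the ray beyond `y`.
  have hrefl : ∀ r : Plane, orient (π.pos y) ((2 : ℝ) • π.pos y - p) r = orient p (π.pos y) r := by
    intro r; simp only [orient, PiLp.sub_apply, PiLp.smul_apply, smul_eq_mul]; ring
  obtain ⟨z, hz, hmin⟩ := exists_angular_min
    (Finset.univ.filter fun w => w ≠ y ∧ π.pos w ≠ p) (by
      obtain ⟨w, hw⟩ := hex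
      exact ⟨w, by simpa using hw⟩) π.pos (π.pos y) ((2 : ℝ) • π.pos y - p) 1 (by
      intro w hw
      rw [hrefl, one_mul]
      have := (Finset.mem_filter.1 hw).2
      exact hp w this.1 this.2)
  have hz' := (Finset.mem_filter.1 hz).2
  refine ⟨z, hz'.1, hz'.2, fun w => ?_⟩
  by_cases h1 : w = y
  · simp [h1]
  by_cases h2 : π.pos w = p
  · rw [h2, orient_rotate]
    exact (hp z hz'.1 hz'.2).le
  · simpa using hmin w (by simp [h1, h2])

/-- The path from `a` to `c` is led around the hull corner `b`, with its bend outside both lines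
`ab` and `bc`. -/
theorem adj_of_hull_path (hG : IsMaximalPlanar G) {a b c : V} (hab : a ≠ b) (hbc : b ≠ c)
    (hac : a ≠ c)
    (h1 : ∀ w, 0 ≤ orient (π.pos a) (π.pos b) (π.pos w))
    (h2 : ∀ w, 0 ≤ orient (π.pos b) (π.pos c) (π.pos w)) : G.Adj a c := by
  have habc := π.orient_pos_of_hull hG hab h1 hac.symm hbc.symm
  have hbca : 0 < orient (π.pos b) (π.pos c) (π.pos a) := by rwa [orient_rotate]
  obtain ⟨q, hq1, hq2, hq3⟩ : ∃ q, orient (π.pos a) (π.pos b) q < 0 ∧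
      orient (π.pos b) (π.pos c) q < 0 ∧ orient (π.pos a) (π.pos c) q ≠ 0 := by
    refine ⟨(1 - 3 : ℝ) • ((1 - (1/2) : ℝ) • π.pos a + (1/2 : ℝ) • π.pos c) + (3 : ℝ) • π.pos b,
      ?_⟩
    simp only [orient_comb, orient_self_left, orient_self_right,
      orient_swap (π.pos a) (π.pos b) (π.pos c)]
    refine ⟨by linarith, by linarith, ?_⟩
    intro h; linarith
  refine π.adj_of_path hG hac q (Or.inl hq3) ?_ ?_
  · intro p hp hs
    have hs := π.orient_nonneg_of_mem_support h1 hs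
    obtain ⟨t, ht0, ht1, rfl⟩ := mem_segment_iff.1 hp
    rw [orient_comb, orient_self_left] at hs
    have : t = 0 := by nlinarith
    simp [this]
  · intro p hp hs
    have hs := π.orient_nonneg_of_mem_support h2 hs
    obtain ⟨t, ht0, ht1, rfl⟩ := mem_segment_iff.1 hp
    rw [orient_comb, orient_self_right] at hs
    have : t = 1 := by nlinarith
    simp [this]

/-- The convex hull of a straight-line drawing of a maximal planar graph is a triangle. -/
theorem exists_outer_triangle [Fintype V] (hG : IsMaximalPlanar G) (hV : 3 < Fintype.card V) :
    ∃ a b c, G.Adj a b ∧ G.Adj b c ∧ G.Adj c a ∧ 0 < orient (π.pos a) (π.pos b) (π.pos c) ∧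
      ∀ w, π.pos w ∈ closedTri (π.pos a) (π.pos b) (π.pos c) := by
  classical
  have hthird : ∀ x y : V, ∃ w, w ≠ x ∧ w ≠ y := by
    intro x y
    by_contra! hcon
    have : (Finset.univ : Finset V) ⊆ {x, y} := by
      intro w _
      by_cases h : w = x
      · simp [h]
      · simp [hcon w h]
    have h2 := Finset.card_le_card this
    have h3 : Finset.card {x, y} ≤ 2 := Finset.card_le_two
    rw [Finset.card_univ] at h2
    omega
  have hne : Nonempty V := Fintype.card_pos_iff.1 (by omega)
  obtain ⟨a, -, ha⟩ := Finset.exists_max_image Finset.univ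
    (fun v => (π.pos v 0) ^ 2 + (π.pos v 1) ^ 2) Finset.univ_nonempty
  -- A vertex of greatest norm is a hull vertex, and `p` lies on the perpendicular at `a` to its
  -- position vector. Here `orient p a w` is `|a|² - a·w`.
  let p : Plane := !₂[π.pos a 0 + π.pos a 1, π.pos a 1 - π.pos a 0]
  have hpa : ∀ w, w ≠ a → 0 < orient p (π.pos a) (π.pos w) := by
    intro w hw
    have hmax := ha w (Finset.mem_univ _)
    simp only [orient, p, Matrix.cons_val_zero, Matrix.cons_val_one]
    by_contra hcon
    refine π.pos_injective.ne hw (plane_ext ?_ ?_) <;>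
      nlinarith [sq_nonneg (π.pos w 0 - π.pos a 0), sq_nonneg (π.pos w 1 - π.pos a 1)]
  have hpne : ∀ w, w ≠ a → π.pos w ≠ p := by
    intro w hw h
    have := hpa w hw
    rw [h, orient_self_left] at this
    exact lt_irrefl _ this
  obtain ⟨b, hba, -, hab⟩ := π.exists_next_hull p a (fun w hw _ => hpa w hw) (by
    obtain ⟨w, hw, -⟩ := hthird a a
    exact ⟨w, hw, hpne w hw⟩)
  have next : ∀ x y : V, x ≠ y → (∀ w, 0 ≤ orient (π.pos x) (π.pos y) (π.pos w)) →
      ∃ z, z ≠ y ∧ z ≠ x ∧ ∀ w, 0 ≤ orient (π.pos y) (π.pos z) (π.pos w) := by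
    intro x y hxy h
    obtain ⟨z, hz, hzx, hz'⟩ := π.exists_next_hull (π.pos x) y (fun w hw hwx =>
      π.orient_pos_of_hull hG hxy h (fun he => hwx (he ▸ rfl)) hw) (by
      obtain ⟨w, hw, hw'⟩ := hthird y x
      exact ⟨w, hw, π.pos_injective.ne hw'⟩)
    exact ⟨z, hz, fun he => hzx (he ▸ rfl), hz'⟩
  obtain ⟨c, hcb, hca, hbc⟩ := next a b hba.symm hab
  obtain ⟨e, hec, heb, hce⟩ := next b c hcb.symm hbc
  have h_ac := π.adj_of_hull_path hG hba.symm hcb.symm hca.symm hab hbc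
  have habc := π.orient_pos_of_hull hG hba.symm hab hca hcb
  by_cases hea : e = a
  · subst hea
    exact ⟨e, b, c, π.adj_of_hull hG hba.symm hab, π.adj_of_hull hG hcb.symm hbc, h_ac.symm,
      habc, fun w => ⟨hab w, hbc w, hce w⟩⟩
  -- With a fourth hull vertex `e`, the edges `ac` and `be` would be crossing diagonals of a convex
  -- quadrilateral.
  · exfalso
    have h_be := π.adj_of_hull_path hG hcb.symm hec.symm heb.symm hbc hce
    have q1 := π.orient_pos_of_hull hG hba.symm hab hea heb
    have q2 := π.orient_pos_of_hull hG hcb.symm hbc heb hec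
    have q3 := π.orient_pos_of_hull hG hec.symm hce hca.symm (Ne.symm hea)
    obtain ⟨x, hx1, hx2⟩ := segments_meet (a := π.pos a) (b := π.pos c) (c := π.pos b)
      (d := π.pos e) (by rw [orient_swap]; linarith) (by rwa [orient_rotate] at q3)
      (by rwa [orient_rotate]) (by rw [orient_swap]; linarith)
    have hne : s(a, c) ≠ s(b, e) := by
      intro h
      rcases Sym2.eq_iff.1 h with ⟨h, -⟩ | ⟨h, -⟩
      · exact hba h.symm
      · exact hea h.symm
    obtain ⟨w, ⟨hw1, hw2⟩, -⟩ := π.segment_inter_segment a c b e h_ac h_be hne ⟨hx1, hx2⟩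
    simp only [Set.mem_insert_iff, Set.mem_singleton_iff] at hw1 hw2
    rcases hw1 with rfl | rfl <;> rcases hw2 with h | h
    · exact hba h.symm
    · exact hea h.symm
    · exact hcb h
    · exact hec h.symm

end StraightLineDrawing

/-! ### Visibility of vertices. -/

namespace StraightLineDrawing

variable {V : Type*} {G : SimpleGraph V} (π : StraightLineDrawing G)

/-- Two vertices or edges that meet are equal or meet in a common vertex. -/
theorem meet {u v x y : V} (huv : G.Adj u v ∨ u = v) (hxy : G.Adj x y ∨ x = y) {q : Plane}
    (h1 : q ∈ segment ℝ (π.pos u) (π.pos v)) (h2 : q ∈ segment ℝ (π.pos x) (π.pos y)) :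
    s(u, v) = s(x, y) ∨ ∃ w, q = π.pos w ∧ (w = u ∨ w = v) ∧ (w = x ∨ w = y) := by
  rcases huv with huv | rfl
  · rcases hxy with hxy | rfl
    · by_cases hne : s(u, v) = s(x, y)
      · exact Or.inl hne
      · obtain ⟨w, hw, rfl⟩ := π.segment_inter_segment u v x y huv hxy hne ⟨h1, h2⟩
        exact Or.inr ⟨w, rfl, by simpa using hw.1, by simpa using hw.2⟩
    · rw [segment_same] at h2
      obtain rfl : q = π.pos x := h2
      exact Or.inr ⟨x, rfl, π.eq_or_eq_of_pos_mem_segment u v x huv h1, Or.inl rfl⟩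
  · rw [segment_same] at h1
    obtain rfl : q = π.pos u := h1
    rcases hxy with hxy | rfl
    · exact Or.inr ⟨u, rfl, Or.inl rfl, π.eq_or_eq_of_pos_mem_segment x y u hxy h2⟩
    · rw [segment_same] at h2
      rw [π.pos_injective (show π.pos u = π.pos x from h2)]
      exact Or.inl rfl

/-- The edge `vb` runs along the ray from `v` to `w`, so the nearer of `b` and `w` lies on the
segment to the other. For `b` this is excluded by `hz`; for `w` it means `w = b`. -/
theorem eq_of_edge_overlap {v b w : V} (hvb : G.Adj v b) (hwv : w ≠ v) {q : Plane}
    (hq : q ∈ openSegment ℝ (π.pos v) (π.pos w)) (hq' : q ∈ segment ℝ (π.pos v) (π.pos b))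
    (hz : π.pos b ∉ openSegment ℝ (π.pos v) (π.pos w)) : w = b := by
  obtain ⟨s, hs0, hs1, hs⟩ := mem_openSegment_iff.1 hq
  obtain ⟨t, ht0, ht1, ht⟩ := mem_segment_iff.1 hq'
  have e : s • (π.pos w - π.pos v) = t • (π.pos b - π.pos v) := by
    have : (1 - s) • π.pos v + s • π.pos w = (1 - t) • π.pos v + t • π.pos b := hs.symm.trans ht
    calc s • (π.pos w - π.pos v) = ((1 - s) • π.pos v + s • π.pos w) - π.pos v := by module
      _ = t • (π.pos b - π.pos v) := by rw [this]; module
  rcases eq_or_lt_of_le ht0 with rfl | ht0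
  · rw [zero_smul, smul_eq_zero] at e
    rcases e with e | e
    · exact absurd e hs0.ne'
    · exact absurd (π.pos_injective (sub_eq_zero.1 e)) hwv
  rcases lt_or_ge s t with hst | hst
  · exfalso
    refine hz (mem_openSegment_iff.2 ⟨s / t, by positivity, by rwa [div_lt_one ht0], ?_⟩)
    have : π.pos b - π.pos v = (s / t) • (π.pos w - π.pos v) := by
      rw [div_eq_inv_mul, mul_smul, e, inv_smul_smul₀ ht0.ne']
    exact (sub_eq_iff_eq_add'.1 this).trans (by module)
  · have hw : π.pos w ∈ segment ℝ (π.pos v) (π.pos b) := by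
      refine mem_segment_iff.2 ⟨t / s, by positivity, by rwa [div_le_one hs0], ?_⟩
      have : π.pos w - π.pos v = (t / s) • (π.pos b - π.pos v) := by
        rw [div_eq_inv_mul, mul_smul, ← e, inv_smul_smul₀ hs0.ne']
      exact (sub_eq_iff_eq_add'.1 this).trans (by module)
    exact (π.eq_or_eq_of_pos_mem_segment v b w hvb hw).resolve_left hwv

/-- Edges at `x` or `y` need no hypothesis: one that meets the open segment `xy` overlaps it and
must be the edge `xy` itself. -/
theorem adj_of_visible' (hG : IsMaximalPlanar G) {x y : V} (hxy : x ≠ y)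
    (hv : ∀ z, π.pos z ∉ openSegment ℝ (π.pos x) (π.pos y))
    (he : ∀ a b, G.Adj a b → a ≠ x → b ≠ x → a ≠ y → b ≠ y →
      ∀ q ∈ openSegment ℝ (π.pos x) (π.pos y), q ∉ segment ℝ (π.pos a) (π.pos b)) :
    G.Adj x y := by
  by_contra hn
  refine hn (π.adj_of_visible hG hxy fun q hq hs => ?_)
  have hq' : q ∈ openSegment ℝ (π.pos y) (π.pos x) := by rwa [openSegment_symm]
  have hv' : ∀ z, π.pos z ∉ openSegment ℝ (π.pos y) (π.pos x) := by
    intro z; rw [openSegment_symm]; exact hv z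
  rcases hs with ⟨z, rfl⟩ | ⟨a, b, hab, hqab⟩
  · exact hv z hq
  have hqba : q ∈ segment ℝ (π.pos b) (π.pos a) := by rwa [segment_symm]
  by_cases hax : a = x
  · subst hax
    have := π.eq_of_edge_overlap hab hxy.symm hq hqab (hv b)
    exact hn (this ▸ hab)
  by_cases hbx : b = x
  · subst hbx
    have := π.eq_of_edge_overlap hab.symm hxy.symm hq hqba (hv a)
    exact hn (this ▸ hab.symm)
  by_cases hay : a = y
  · subst hay
    have := π.eq_of_edge_overlap hab hxy hq' hqab (hv' b)
    exact hn (this ▸ hab.symm)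
  by_cases hby : b = y
  · subst hby
    have := π.eq_of_edge_overlap hab.symm hxy hq' hqba (hv' a)
    exact hn (this ▸ hab)
  exact he a b hab hax hbx hay hby q hq hqab

/-- The vertex `w` is visible from the point `p`, where edges ending in `p` are ignored. -/
def Visible (p : Plane) (w : V) : Prop :=
  (∀ z, π.pos z ∉ openSegment ℝ p (π.pos w)) ∧
    ∀ a b, G.Adj a b → π.pos a ≠ p → π.pos b ≠ p →
      ∀ q ∈ openSegment ℝ p (π.pos w), q ∉ segment ℝ (π.pos a) (π.pos b)

/-- When the view from `p` is blocked at a point `b` inside the edge `uv`, sweep the ray `pb`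
towards `u` within the triangle `p b u`. The first vertex met, nearest to `p` in case of ties, is
visible from `p`. -/
theorem exists_visible_in_triangle [Fintype V] {p b : Plane} {u v : V} {σ : ℝ}
    (hp : ∀ a c, G.Adj a c → π.pos a ≠ p → π.pos c ≠ p → p ∉ segment ℝ (π.pos a) (π.pos c))
    (huv : G.Adj u v) (hup : π.pos u ≠ p)
    (hb : b ∈ segment ℝ (π.pos u) (π.pos v)) (hbv : ∀ z, π.pos z ≠ b)
    (hΔ : 0 < σ * orient p b (π.pos u))
    (hfree : ∀ a c, G.Adj a c ∨ a = c → π.pos a ≠ p → π.pos c ≠ p →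
      ∀ q ∈ openSegment ℝ p b, q ∉ segment ℝ (π.pos a) (π.pos c)) :
    ∃ w, 0 ≤ σ * orient p b (π.pos w) ∧ 0 ≤ σ * orient (π.pos u) p (π.pos w) ∧
      0 < σ * orient p b (π.pos w) + σ * orient (π.pos u) p (π.pos w) ∧ π.Visible p w := by
  classical
  have hpb : p ≠ b := by rintro rfl; simp at hΔ
  have hσ : σ ≠ 0 := by rintro rfl; simp at hΔ
  have hsum : ∀ q, σ * orient p b q + σ * orient b (π.pos u) q + σ * orient (π.pos u) p q =
      σ * orient p b (π.pos u) := by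
    intro q; rw [← orient_sum p b (π.pos u) q]; ring
  set Δ := σ * orient p b (π.pos u) with hΔdef
  -- Scaled barycentric coordinates of the triangle `p b u` with sum `Δ`: `φ₁`, `φ₂`, `φ₃` vanish on
  -- the lines `pb`, `bu`, `up`.
  set φ₁ : Plane → ℝ := fun q => σ * orient p b q with hφ₁
  set φ₂ : Plane → ℝ := fun q => σ * orient b (π.pos u) q with hφ₂
  set φ₃ : Plane → ℝ := fun q => σ * orient (π.pos u) p q with hφ₃
  have hφ₁c : Continuous φ₁ := (continuous_orient _ _).const_mul σ
  have hφ₂c : Continuous φ₂ := (continuous_orient _ _).const_mul σ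
  have comb₁ : ∀ x y t, φ₁ ((1 - t) • x + t • y) = (1 - t) * φ₁ x + t * φ₁ y := by
    intro x y t; simp only [hφ₁, orient_comb]; ring
  have comb₂ : ∀ x y t, φ₂ ((1 - t) • x + t • y) = (1 - t) * φ₂ x + t * φ₂ y := by
    intro x y t; simp only [hφ₂, orient_comb]; ring
  have comb₃ : ∀ x y t, φ₃ ((1 - t) • x + t • y) = (1 - t) * φ₃ x + t * φ₃ y := by
    intro x y t; simp only [hφ₃, orient_comb]; ring
  have hsum' : ∀ q, φ₁ q + φ₂ q + φ₃ q = Δ := hsum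
  have hp1 : φ₁ p = 0 := by simp [hφ₁]
  have hp3 : φ₃ p = 0 := by simp [hφ₃]
  have hp2 : φ₂ p = Δ := by have := hsum' p; linarith
  have hrel : ∀ w z, φ₁ w * φ₃ z - φ₁ z * φ₃ w = Δ * (σ * orient p z w) := by
    intro w z; simp only [hφ₁, hφ₃, hΔdef, orient]; ring
  -- the candidates
  let W : Finset V := Finset.univ.filter fun w =>
    π.pos w ≠ p ∧ 0 ≤ φ₁ (π.pos w) ∧ 0 ≤ φ₂ (π.pos w) ∧ 0 ≤ φ₃ (π.pos w)
  have hW : ∀ w, w ∈ W ↔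
      π.pos w ≠ p ∧ 0 ≤ φ₁ (π.pos w) ∧ 0 ≤ φ₂ (π.pos w) ∧ 0 ≤ φ₃ (π.pos w) := by
    intro w; simp [W]
  have hh : ∀ q, q ≠ p → 0 ≤ φ₁ q → 0 ≤ φ₃ q → 0 < φ₁ q + φ₃ q := by
    intro q hqp h1 h3
    by_contra hcon
    have e1 : orient p b q = 0 := (mul_eq_zero.1 (show φ₁ q = 0 by linarith)).resolve_left hσ
    have e3 : orient (π.pos u) p q = 0 :=
      (mul_eq_zero.1 (show φ₃ q = 0 by linarith)).resolve_left hσ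
    have hb := bary_point p b (π.pos u) q
    have hs := orient_sum p b (π.pos u) q
    rw [e1, e3] at hs
    rw [e1, e3, zero_smul, zero_smul, add_zero, add_zero] at hb
    have : orient b (π.pos u) q = orient p b (π.pos u) := by linarith
    rw [this] at hb
    have hne : orient p b (π.pos u) ≠ 0 := by intro h; rw [hΔdef, h] at hΔ; simp at hΔ
    exact hqp ((smul_right_inj hne).1 hb)
  have hφ₁W : ∀ w ∈ W, 0 < φ₁ (π.pos w) := by
    intro w hw
    obtain ⟨hwp, h1, h2, h3⟩ := (hW w).1 hw
    refine lt_of_le_of_ne h1 fun h0 => ?_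
    have hseg : π.pos w ∈ segment ℝ p b := mem_segment_of_orient_smul hΔ h0.symm h2 h3
    rw [← insert_endpoints_openSegment] at hseg
    rcases hseg with h | h | h
    · exact hwp h
    · exact hbv w h
    · exact hfree w w (Or.inr rfl) hwp hwp _ h (by simp)
  have huW : u ∈ W := by
    rw [hW]
    have e1 : φ₁ (π.pos u) = Δ := rfl
    have e2 : φ₂ (π.pos u) = 0 := by simp [hφ₂]
    have e3 : φ₃ (π.pos u) = 0 := by simp [hφ₃]
    exact ⟨hup, by linarith, by linarith, by linarith⟩
  -- The first key orders the candidates by angle from the ray `pb`. The second prefers large `φ₂`,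
  -- that is, among points on one ray, the one nearest to `p`.
  obtain ⟨w, hw, hmin⟩ := Finset.exists_min_image W
    (fun w => toLex (φ₁ (π.pos w) / (φ₁ (π.pos w) + φ₃ (π.pos w)), -φ₂ (π.pos w))) ⟨u, huW⟩
  obtain ⟨hwp, hw1, hw2, hw3⟩ := (hW w).1 hw
  have hwh := hh _ hwp hw1 hw3
  have hw1' := hφ₁W w hw
  have hA : ∀ z ∈ W, σ * orient p (π.pos z) (π.pos w) < 0 ∨
      (σ * orient p (π.pos z) (π.pos w) = 0 ∧ φ₂ (π.pos z) ≤ φ₂ (π.pos w)) := by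
    intro z hz
    obtain ⟨hzp, hz1, hz2, hz3⟩ := (hW z).1 hz
    have hzh := hh _ hzp hz1 hz3
    have hr := hrel (π.pos w) (π.pos z)
    have := hmin z hz
    rw [Prod.Lex.toLex_le_toLex] at this
    rcases this with h | ⟨h, h'⟩
    · left
      simp only at h
      rw [div_lt_div_iff₀ hwh hzh] at h
      by_contra hcon
      have := mul_nonneg hΔ.le (not_lt.1 hcon)
      nlinarith
    · right
      simp only at h h'
      rw [div_eq_div_iff hwh.ne' hzh.ne'] at h
      have h0 : Δ * (σ * orient p (π.pos z) (π.pos w)) = 0 := by rw [← hr]; linarith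
      exact ⟨(mul_eq_zero.1 h0).resolve_left hΔ.ne', by linarith⟩
  refine ⟨w, hw1, hw3, hwh, ?_, ?_⟩
  · intro z hz
    obtain ⟨s, hs0, hs1, hs⟩ := mem_openSegment_iff.1 hz
    have k1 := comb₁ p (π.pos w) s
    have k2 := comb₂ p (π.pos w) s
    have k3 := comb₃ p (π.pos w) s
    rw [← hs, hp1] at k1
    rw [← hs, hp2] at k2
    rw [← hs, hp3] at k3
    have hsw := hsum' (π.pos w)
    have hz1 : 0 < φ₁ (π.pos z) := by have := mul_pos hs0 hw1'; linarith
    have hz2 : φ₂ (π.pos w) < φ₂ (π.pos z) := by nlinarith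
    have hz3 : 0 ≤ φ₃ (π.pos z) := by have := mul_nonneg hs0.le hw3; linarith
    have hzp : π.pos z ≠ p := by intro h; rw [h, hp1] at hz1; exact lt_irrefl _ hz1
    have h0 : σ * orient p (π.pos z) (π.pos w) = 0 := by
      rw [hs, orient_swap, orient_comb]; simp
    rcases hA z ((hW z).2 ⟨hzp, hz1.le, by linarith, hz3⟩) with h | ⟨-, h⟩ <;> linarith
  · intro x y hxy hxp hyp c hc hcxy
    obtain ⟨s, hs0, hs1, hs⟩ := mem_openSegment_iff.1 hc
    have k1 := comb₁ p (π.pos w) s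
    have k2 := comb₂ p (π.pos w) s
    rw [← hs, hp1] at k1
    rw [← hs, hp2] at k2
    have hsw := hsum' (π.pos w)
    have hc1 : 0 < φ₁ c := by have := mul_pos hs0 hw1'; linarith
    have hc2 : φ₂ (π.pos w) < φ₂ c := by nlinarith
    have hpc : orient p c (π.pos w) = 0 := by rw [hs, orient_swap, orient_comb]; simp
    have hside : ∀ q r t, orient p ((1 - t) • q + t • r) (π.pos w) =
        (1 - t) * orient p q (π.pos w) + t * orient p r (π.pos w) := by
      intro q r t
      rw [orient_swap, orient_comb, orient_swap p q, orient_swap p r]; ring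
    have hnotuv : ∀ x y : V, c ∈ segment ℝ (π.pos x) (π.pos y) → s(x, y) ≠ s(u, v) := by
      intro x y hcxy he
      have hcuv : c ∈ segment ℝ (π.pos u) (π.pos v) := by
        rcases Sym2.eq_iff.1 he with ⟨rfl, rfl⟩ | ⟨rfl, rfl⟩
        · exact hcxy
        · rwa [segment_symm]
      obtain ⟨t, -, -, ht⟩ := mem_segment_iff.1 hcuv
      obtain ⟨t', -, -, ht'⟩ := mem_segment_iff.1 hb
      have : φ₂ c = 0 := by
        simp only [hφ₂, ht, ht', orient, PiLp.add_apply, PiLp.smul_apply, smul_eq_mul]; ring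
      linarith
    -- An edge through `c` cannot leave the triangle on the side of `pw` towards `b`: the segment
    -- `pb` is free, and `bu` is part of the edge `uv`, which it can meet only in a common end. So
    -- an end on that side is a candidate.
    have hB : ∀ x y : V, G.Adj x y → π.pos x ≠ p → π.pos y ≠ p →
        c ∈ segment ℝ (π.pos x) (π.pos y) → 0 ≤ σ * orient p (π.pos x) (π.pos w) → x ∈ W := by
      intro x y hxy hxp hyp hcxy hx0
      by_cases hcone : 0 ≤ φ₁ (π.pos x) ∧ 0 ≤ φ₂ (π.pos x)
      · rw [hW]
        refine ⟨hxp, hcone.1, hcone.2, ?_⟩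
        have := hrel (π.pos w) (π.pos x)
        have h5 := mul_nonneg hΔ.le hx0
        have h6 := mul_nonneg hcone.1 hw3
        have : 0 ≤ φ₁ (π.pos w) * φ₃ (π.pos x) := by linarith
        exact nonneg_of_mul_nonneg_right this hw1'
      · exfalso
        obtain ⟨q, hq, hq1, hq2, hq0⟩ := exists_exit_wedge hφ₁c hφ₂c hc1 (by linarith) hcone
        have hqxy : q ∈ segment ℝ (π.pos x) (π.pos y) :=
          (convex_segment _ _).segment_subset hcxy (left_mem_segment _ _ _) hq
        have hqw : 0 ≤ σ * orient p q (π.pos w) := by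
          obtain ⟨t, ht0, ht1, ht⟩ := mem_segment_iff.1 hq
          rw [ht, hside, hpc, mul_zero, zero_add, mul_left_comm]
          exact mul_nonneg ht0 hx0
        have hq3 : 0 ≤ φ₃ q := by
          have := hrel (π.pos w) q
          have h5 := mul_nonneg hΔ.le hqw
          have h6 := mul_nonneg hq1 hw3
          have : 0 ≤ φ₁ (π.pos w) * φ₃ q := by linarith
          exact nonneg_of_mul_nonneg_right this hw1'
        rcases hq0 with hq0 | hq0
        · have hseg : q ∈ segment ℝ p b := mem_segment_of_orient_smul hΔ hq0 hq2 hq3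
          rw [← insert_endpoints_openSegment] at hseg
          rcases hseg with h | h | h
          · exact hp x y hxy hxp hyp (h ▸ hqxy)
          · rw [Set.mem_singleton_iff.1 h] at hqxy
            rcases π.meet (Or.inl hxy) (Or.inl huv) hqxy hb with h | ⟨z, hz, -⟩
            · exact hnotuv x y hcxy h
            · exact hbv z hz.symm
          · exact hfree x y (Or.inl hxy) hxp hyp _ h hqxy
        · have hseg : q ∈ segment ℝ b (π.pos u) :=
            mem_segment_of_orient_smul (by rwa [orient_rotate]) hq0 hq3 hq1
          have hquv : q ∈ segment ℝ (π.pos u) (π.pos v) :=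
            (convex_segment _ _).segment_subset hb (left_mem_segment _ _ _) hseg
          rcases π.meet (Or.inl hxy) (Or.inl huv) hqxy hquv with h | ⟨z, rfl, hz | hz, -⟩
          · exact hnotuv x y hcxy h
          · subst hz; exact hcone ⟨hq1, hq2⟩
          -- The exit point would be the other end of the edge, where `φ₂` vanishes; but `φ₂` is
          -- positive at `c` and hence on the stretch from `c` to `x`.
          · subst hz
            obtain ⟨t, ht0, ht1, ht⟩ := mem_segment_iff.1 hcxy
            obtain ⟨r, hr0, hr1, hr⟩ := mem_segment_iff.1 hq
            have e1 := comb₂ (π.pos x) (π.pos z) t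
            have e2 := comb₂ c (π.pos x) r
            rw [← ht, hq0, mul_zero, add_zero] at e1
            rw [← hr, hq0] at e2
            have : 0 < φ₂ (π.pos x) := by
              by_contra hcon
              have := mul_nonneg (sub_nonneg.2 ht1) (neg_nonneg.2 (not_lt.1 hcon))
              linarith
            have hφc : 0 < φ₂ c := by linarith
            rcases eq_or_lt_of_le hr0 with rfl | hr0
            · linarith
            · have := mul_pos hr0 this
              have := mul_nonneg (sub_nonneg.2 hr1) hφc.le
              linarith
    -- By minimality neither end lies strictly on the side of `pw` towards `b`. Since `c` is on the
    -- line `pw`, so is each end of positive weight; it then has `φ₂` at most `φ₂ w`, which is less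
    -- than `φ₂ c`.
    obtain ⟨t, ht0, ht1, ht⟩ := mem_segment_iff.1 hcxy
    have hcomb := hside (π.pos x) (π.pos y) t
    rw [← ht, hpc] at hcomb
    have hcomb' : 0 = (1 - t) * (σ * orient p (π.pos x) (π.pos w)) +
        t * (σ * orient p (π.pos y) (π.pos w)) := by linear_combination σ * hcomb
    have hcyx : c ∈ segment ℝ (π.pos y) (π.pos x) := by rwa [segment_symm]
    have ex : ¬ 0 < σ * orient p (π.pos x) (π.pos w) := fun h => by
      rcases hA x (hB x y hxy hxp hyp hcxy h.le) with h' | h' <;> linarith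
    have ey : ¬ 0 < σ * orient p (π.pos y) (π.pos w) := fun h => by
      rcases hA y (hB y x hxy.symm hyp hxp hcyx h.le) with h' | h' <;> linarith
    have hc2' := comb₂ (π.pos x) (π.pos y) t
    rw [← ht] at hc2'
    have gx : 0 ≤ σ * orient p (π.pos x) (π.pos w) → φ₂ (π.pos x) ≤ φ₂ (π.pos w) := fun h => by
      rcases hA x (hB x y hxy hxp hyp hcxy h) with h' | h' <;> linarith
    have gy : 0 ≤ σ * orient p (π.pos y) (π.pos w) → φ₂ (π.pos y) ≤ φ₂ (π.pos w) := fun h => by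
      rcases hA y (hB y x hxy.symm hyp hxp hcyx h) with h' | h' <;> linarith
    rcases eq_or_lt_of_le ht0 with rfl | ht0
    · have := gx (by linarith)
      linarith
    rcases eq_or_lt_of_le ht1 with rfl | ht1
    · have := gy (by linarith)
      linarith
    have gx' := gx (by nlinarith)
    have gy' := gy (by nlinarith)
    nlinarith

/-- If a vertex lies on one side of a line through `p`, some such vertex is visible from `p`. -/
theorem exists_visible [Fintype V] {p : Plane}
    (hp : ∀ a c, G.Adj a c → π.pos a ≠ p → π.pos c ≠ p → p ∉ segment ℝ (π.pos a) (π.pos c))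
    (x y : Plane) (w₀ : V) (h0 : orient x y p < orient x y (π.pos w₀)) :
    ∃ w, orient x y p < orient x y (π.pos w) ∧ π.Visible p w := by
  classical
  -- Pairs with equal entries are included so that single vertices obstruct the view like edges do.
  let E : Set (V × V) := {e | (G.Adj e.1 e.2 ∨ e.1 = e.2) ∧ π.pos e.1 ≠ p ∧ π.pos e.2 ≠ p}
  let K : Set Plane := ⋃ e ∈ E, segment ℝ (π.pos e.1) (π.pos e.2)
  have hK : ∀ q, q ∈ K ↔ ∃ a c, (G.Adj a c ∨ a = c) ∧ π.pos a ≠ p ∧ π.pos c ≠ p ∧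
      q ∈ segment ℝ (π.pos a) (π.pos c) := by
    intro q; simp [K, E, and_assoc]
  have hKcl : IsClosed K := by
    refine (Set.toFinite E).isClosed_biUnion fun e _ => ?_
    rw [← convexHull_pair]
    exact ((Set.toFinite _).isCompact_convexHull ℝ).isClosed
  have hpK : p ∉ K := by
    rw [hK]
    rintro ⟨a, c, h | rfl, hap, hcp, hpac⟩
    · exact hp a c h hap hcp hpac
    · rw [segment_same] at hpac; exact hap (Set.mem_singleton_iff.1 hpac).symm
  have hw₀p : π.pos w₀ ≠ p := by intro h; rw [h] at h0; exact lt_irrefl _ h0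
  let g : ℝ → Plane := fun t => (1 - t) • p + t • π.pos w₀
  have hg : Continuous g := by fun_prop
  -- Compactness yields the first obstacle `b = g t` on the way from `p` to `w₀`.
  have hT : IsCompact (Set.Icc (0 : ℝ) 1 ∩ g ⁻¹' K) := isCompact_Icc.inter_right (hKcl.preimage hg)
  obtain ⟨t, ⟨⟨ht0, ht1⟩, htK⟩, htmin⟩ := hT.exists_isLeast
    ⟨1, ⟨zero_le_one, le_rfl⟩, by
      show g 1 ∈ K
      rw [hK]; exact ⟨w₀, w₀, Or.inr rfl, hw₀p, hw₀p, by simp [g]⟩⟩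
  have htpos : 0 < t := lt_of_le_of_ne ht0 (by rintro rfl; apply hpK; simpa [g] using htK)
  obtain ⟨b, hbg⟩ : ∃ b, b = g t := ⟨_, rfl⟩
  have htK' : b ∈ K := by rw [hbg]; exact htK
  have hfb : orient x y p < orient x y b := by
    rw [hbg]; simp only [g]; rw [orient_comb]; nlinarith
  have hpb : p ≠ b := by rintro rfl; exact hpK htK'
  have hfree : ∀ q ∈ openSegment ℝ p b, q ∉ K := by
    intro q hq hqK
    obtain ⟨s, hs0, hs1, hs⟩ := mem_openSegment_iff.1 hq
    have : q = g (s * t) := by rw [hs, hbg]; simp only [g]; module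
    have hle := htmin (a := s * t) ⟨⟨by positivity, by nlinarith⟩, by
      show g (s * t) ∈ K
      rwa [← this]⟩
    nlinarith
  have hfree' : ∀ a c, G.Adj a c ∨ a = c → π.pos a ≠ p → π.pos c ≠ p →
      ∀ q ∈ openSegment ℝ p b, q ∉ segment ℝ (π.pos a) (π.pos c) :=
    fun a c h ha hc q hq hqac => hfree q hq ((hK q).2 ⟨a, c, h, ha, hc, hqac⟩)
  by_cases hbv : ∃ z, π.pos z = b
  · obtain ⟨z, hz⟩ := hbv
    refine ⟨z, by rwa [hz], ?_, ?_⟩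
    · intro z' hz'
      rw [hz] at hz'
      by_cases h : π.pos z' = p
      · rw [h, left_mem_openSegment_iff] at hz'; exact hpb hz'
      · exact hfree' z' z' (Or.inr rfl) h h _ hz' (by simp)
    · intro a c hac ha hc q hq
      rw [hz] at hq
      exact hfree' a c (Or.inl hac) ha hc q hq
  push Not at hbv
  -- Of the two ends of the blocking edge, `u` is one at which `orient x y` is no smaller than at
  -- `b`, so turning towards it stays on the wanted side.
  obtain ⟨u, v, huv, hup, hvp, hbuv, hfu⟩ : ∃ u v, G.Adj u v ∧ π.pos u ≠ p ∧ π.pos v ≠ p ∧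
      b ∈ segment ℝ (π.pos u) (π.pos v) ∧ orient x y b ≤ orient x y (π.pos u) := by
    obtain ⟨u, v, h | rfl, hup, hvp, hb⟩ := (hK b).1 htK'
    · obtain ⟨s, hs0, hs1, hs⟩ := mem_segment_iff.1 hb
      by_cases hle : orient x y b ≤ orient x y (π.pos u)
      · exact ⟨u, v, h, hup, hvp, hb, hle⟩
      · refine ⟨v, u, h.symm, hvp, hup, by rwa [segment_symm], ?_⟩
        have := orient_comb x y (π.pos u) (π.pos v) s
        rw [← hs] at this
        by_contra hcon
        have h1 := sub_pos.2 (not_le.1 hle)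
        have h2 := sub_pos.2 (not_le.1 hcon)
        have h3 := mul_nonneg (sub_nonneg.2 hs1) h1.le
        rcases eq_or_lt_of_le hs0 with rfl | hs0
        · linarith
        · have := mul_pos hs0 h2
          linarith
    · rw [segment_same] at hb; exact absurd (Set.mem_singleton_iff.1 hb).symm (hbv u)
  obtain ⟨t', ht'0, ht'1, hb'⟩ := mem_segment_iff.1 hbuv
  -- If `p`, `b`, `u` were collinear, points just before `b` on `pb` would already lie on the edge
  -- `uv`, and `b` would not be the first obstacle.
  have hne : orient p b (π.pos u) ≠ 0 := by
    intro h0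
    have h0' : orient b (π.pos u) p = 0 := by rwa [orient_rotate]
    obtain ⟨r, hr⟩ := exists_comb_of_orient_eq_zero (hbv u).symm h0'
    have ht'pos : 0 < t' := lt_of_le_of_ne ht'0 (by rintro rfl; exact hbv u (by simp [hb']))
    have ht'lt : t' < 1 := lt_of_le_of_ne ht'1 (by rintro rfl; exact hbv v (by simp [hb']))
    have habs : 0 < 1 + |r| := by positivity
    -- Small enough to keep the weight `t' * (1 - ε * r)` of `v` between 0 and 1.
    set ε := (1 - t') / (1 + |r|) with hε
    have hε0 : 0 < ε := div_pos (by linarith) habs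
    have hεr : ε * (1 + |r|) = 1 - t' := by rw [hε]; field_simp
    have hε1 : ε < 1 := by nlinarith [abs_nonneg r]
    have hεr1 : ε * r ≤ 1 - t' := by nlinarith [le_abs_self r]
    have hεr2 : -(1 - t') ≤ ε * r := by nlinarith [neg_abs_le r]
    refine hfree ((1 - ε) • b + ε • p) ?_ ((hK _).2 ⟨u, v, Or.inl huv, hup, hvp, ?_⟩)
    · rw [openSegment_symm]
      exact mem_openSegment_iff.2 ⟨ε, hε0, hε1, rfl⟩
    · refine mem_segment_iff.2 ⟨t' * (1 - ε * r), by nlinarith, by nlinarith, ?_⟩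
      rw [hr, hb']; module
  obtain ⟨σ, hσ⟩ : ∃ σ : ℝ, 0 < σ * orient p b (π.pos u) :=
    ⟨orient p b (π.pos u), mul_self_pos.2 hne⟩
  obtain ⟨w, hw1, hw3, hw, hvis⟩ := π.exists_visible_in_triangle hp huv hup hbuv hbv hσ hfree'
  refine ⟨w, ?_, hvis⟩
  have hb1 := orient_bary p b (π.pos u) x y (π.pos w)
  have hs1 := orient_sum p b (π.pos u) (π.pos w)
  -- The vertex `w` lies in the cone at `p` spanned by `b` and `u`, and the affine function `orient
  -- x y` grows from `p` towards both.
  have key : (σ * orient p b (π.pos u)) * (orient x y (π.pos w) - orient x y p) =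
      (σ * orient (π.pos u) p (π.pos w)) * (orient x y b - orient x y p) +
      (σ * orient p b (π.pos w)) * (orient x y (π.pos u) - orient x y p) := by
    linear_combination σ * hb1 + σ * orient x y p * hs1
  have : 0 < (σ * orient p b (π.pos u)) * (orient x y (π.pos w) - orient x y p) := by
    rw [key]
    nlinarith
  exact sub_pos.1 ((mul_pos_iff_of_pos_left hσ).1 this)

end StraightLineDrawing

/-! ### Empty triangles. -/

namespace StraightLineDrawing

variable {V : Type*} {G : SimpleGraph V} (π : StraightLineDrawing G)

/-- A vertex visible from the point `π.pos v` is adjacent to `v`, since the edges at `v` that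
`Visible` ignores are harmless in `adj_of_visible'`. -/
theorem exists_neighbor [Fintype V] (hG : IsMaximalPlanar G) (v : V) (x y : Plane) (w₀ : V)
    (h0 : orient x y (π.pos v) < orient x y (π.pos w₀)) :
    ∃ w, G.Adj v w ∧ orient x y (π.pos v) < orient x y (π.pos w) := by
  obtain ⟨w, hw, hv1, hv2⟩ := π.exists_visible (p := π.pos v) (fun a c hac ha hc hmem => by
    rcases π.eq_or_eq_of_pos_mem_segment a c v hac hmem with rfl | rfl
    · exact ha rfl
    · exact hc rfl) x y w₀ h0
  have hne : v ≠ w := by rintro rfl; exact lt_irrefl _ hw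
  exact ⟨w, π.adj_of_visible' hG hne hv1 fun a b hab ha hb _ _ =>
    hv2 a b hab (π.pos_injective.ne ha) (π.pos_injective.ne hb), hw⟩

/-- Three pairwise adjacent vertices in counterclockwise order such that the closed triangle that
they span contains no other vertex. -/
def IsEmptyTri (a b c : V) : Prop :=
  G.Adj a b ∧ G.Adj b c ∧ G.Adj c a ∧ 0 < orient (π.pos a) (π.pos b) (π.pos c) ∧
    ∀ w, π.pos w ∈ closedTri (π.pos a) (π.pos b) (π.pos c) → w = a ∨ w = b ∨ w = c

/-- Two neighbours that are consecutive around a vertex, at an angle less than `π`, span an empty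
triangle. -/
theorem isEmptyTri_of_sector [Fintype V] (hG : IsMaximalPlanar G) {v x y : V} (hvx : G.Adj v x)
    (hvy : G.Adj v y) (hpos : 0 < orient (π.pos v) (π.pos x) (π.pos y))
    (hsec : ∀ z, G.Adj v z → ¬(0 < orient (π.pos v) (π.pos x) (π.pos z) ∧
      0 < orient (π.pos y) (π.pos v) (π.pos z))) : π.IsEmptyTri v x y := by
  classical
  set φ₁ : Plane → ℝ := fun q => orient (π.pos v) (π.pos x) q with hφ₁
  set φ₂ : Plane → ℝ := fun q => orient (π.pos y) (π.pos v) q with hφ₂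
  set φ₃ : Plane → ℝ := fun q => orient (π.pos x) (π.pos y) q with hφ₃
  set H := orient (π.pos v) (π.pos x) (π.pos y) with hH
  have hsum : ∀ q, φ₁ q + φ₃ q + φ₂ q = H := fun q => orient_sum _ _ _ q
  have comb₁ : ∀ a b t, φ₁ ((1 - t) • a + t • b) = (1 - t) * φ₁ a + t * φ₁ b :=
    fun a b t => orient_comb _ _ a b t
  have comb₂ : ∀ a b t, φ₂ ((1 - t) • a + t • b) = (1 - t) * φ₂ a + t * φ₂ b :=
    fun a b t => orient_comb _ _ a b t
  have comb₃ : ∀ a b t, φ₃ ((1 - t) • a + t • b) = (1 - t) * φ₃ a + t * φ₃ b :=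
    fun a b t => orient_comb _ _ a b t
  have v1 : φ₁ (π.pos v) = 0 := by simp [hφ₁]
  have v2 : φ₂ (π.pos v) = 0 := by simp [hφ₂]
  have v3 : φ₃ (π.pos v) = H := by have := hsum (π.pos v); linarith
  have x1 : φ₁ (π.pos x) = 0 := by simp [hφ₁]
  have x3 : φ₃ (π.pos x) = 0 := by simp [hφ₃]
  have x2 : φ₂ (π.pos x) = H := by have := hsum (π.pos x); linarith
  have y2 : φ₂ (π.pos y) = 0 := by simp [hφ₂]
  have y3 : φ₃ (π.pos y) = 0 := by simp [hφ₃]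
  have y1 : φ₁ (π.pos y) = H := rfl
  have hyv : 0 < orient (π.pos y) (π.pos v) (π.pos x) := by rwa [orient_rotate, orient_rotate]
  -- an edge crossing the sector stays in it on the side of `v`
  have hC : ∀ z z' c, G.Adj z z' → z ≠ v → z' ≠ v → c ∈ segment ℝ (π.pos z) (π.pos z') →
      0 < φ₁ c → 0 < φ₂ c → 0 ≤ φ₃ c → φ₃ c ≤ φ₃ (π.pos z) →
      (0 < φ₃ c ∨ (z ≠ x ∧ z' ≠ x ∧ z ≠ y ∧ z' ≠ y)) →
      π.pos z ∈ closedTri (π.pos v) (π.pos x) (π.pos y) := by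
    intro z z' c hzz hzv hzv' hc hc1 hc2 hc3 hle hor
    by_contra hcon
    have hcone : ¬(0 ≤ φ₁ (π.pos z) ∧ 0 ≤ φ₂ (π.pos z)) :=
      fun h => hcon ⟨h.1, hc3.trans hle, h.2⟩
    obtain ⟨q, hq, hq1, hq2, hq0⟩ := exists_exit_wedge (continuous_orient _ _)
      (continuous_orient _ _) hc1 hc2 hcone
    have hqzz : q ∈ segment ℝ (π.pos z) (π.pos z') :=
      (convex_segment _ _).segment_subset hc (left_mem_segment _ _ _) hq
    have hq3 : φ₃ c ≤ φ₃ q := by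
      obtain ⟨t, ht0, ht1, ht⟩ := mem_segment_iff.1 hq
      rw [ht, comb₃]; nlinarith
    have hq3' : 0 ≤ φ₃ q := hc3.trans hq3
    have hfin : ∀ u, (u = x ∨ u = y) → φ₃ (π.pos u) = 0 → G.Adj v u →
        q ∈ segment ℝ (π.pos v) (π.pos u) → False := by
      intro u hu hu3 hvu hqu
      rcases π.meet (Or.inl hzz) (Or.inl hvu) hqzz hqu with h | ⟨w, rfl, hw, hw'⟩
      · rcases Sym2.eq_iff.1 h with ⟨h, -⟩ | ⟨-, h⟩
        · exact hzv h
        · exact hzv' h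
      · have hwv : w ≠ v := by rcases hw with rfl | rfl <;> assumption
        obtain rfl := hw'.resolve_left hwv
        rcases hor with h | ⟨e1, e2, e3, e4⟩
        · linarith
        · rcases hw with rfl | rfl <;> rcases hu with h | h <;> contradiction
    rcases hq0 with hq0 | hq0
    · exact hfin x (Or.inl rfl) x3 hvx (mem_segment_of_orient hpos hq0 hq3' hq2)
    · refine hfin y (Or.inr rfl) y3 hvy ?_
      rw [segment_symm]
      exact mem_segment_of_orient hyv hq0 hq1 hq3'
  have hempty : ∀ w, π.pos w ∈ closedTri (π.pos v) (π.pos x) (π.pos y) →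
      w = v ∨ w = x ∨ w = y := by
    by_contra! hcon
    obtain ⟨w₀, hw₀⟩ := hcon
    -- A further vertex of the triangle farthest from the line `xy` (largest `φ₃`) sees `v`, so it
    -- is a neighbour of `v` in the open sector, against `hsec`.
    let W : Finset V := Finset.univ.filter fun w =>
      π.pos w ∈ closedTri (π.pos v) (π.pos x) (π.pos y) ∧ w ≠ v ∧ w ≠ x ∧ w ≠ y
    obtain ⟨w, hw, hmax⟩ := Finset.exists_max_image W (fun w => φ₃ (π.pos w))
      ⟨w₀, by simpa [W] using hw₀⟩
    obtain ⟨⟨h1, h3, h2⟩, hwv, hwx, hwy⟩ := (Finset.mem_filter.1 hw).2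
    have h1' : 0 < φ₁ (π.pos w) := by
      refine lt_of_le_of_ne h1 fun h0 => ?_
      rcases π.eq_or_eq_of_pos_mem_segment v x w hvx
        (mem_segment_of_orient hpos h0.symm h3 h2) with h | h
      exacts [hwv h, hwx h]
    have h2' : 0 < φ₂ (π.pos w) := by
      refine lt_of_le_of_ne h2 fun h0 => ?_
      rcases π.eq_or_eq_of_pos_mem_segment y v w hvy.symm
        (mem_segment_of_orient hyv h0.symm h1 h3) with h | h
      exacts [hwy h, hwv h]
    have h3' : 0 ≤ φ₃ (π.pos w) := h3
    have hsw := hsum (π.pos w)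
    have hopen : ∀ c ∈ openSegment ℝ (π.pos v) (π.pos w),
        0 < φ₁ c ∧ 0 < φ₂ c ∧ φ₃ (π.pos w) < φ₃ c := by
      intro c hc
      obtain ⟨s, hs0, hs1, rfl⟩ := mem_openSegment_iff.1 hc
      rw [comb₁, comb₂, comb₃, v1, v2, v3]
      have := mul_pos hs0 h1'
      have := mul_pos hs0 h2'
      refine ⟨by linarith, by linarith, by nlinarith⟩
    refine hsec w (π.adj_of_visible' hG hwv.symm ?_ ?_) ⟨h1', h2'⟩
    · intro z hz
      obtain ⟨g1, g2, g3⟩ := hopen _ hz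
      have hzW : z ∈ W := by
        refine Finset.mem_filter.2 ⟨Finset.mem_univ _,
          ⟨g1.le, (h3'.trans g3.le), g2.le⟩, ?_, ?_, ?_⟩
        · rintro rfl; linarith
        · rintro rfl; linarith
        · rintro rfl; linarith
      exact absurd (hmax z hzW) (not_le.2 g3)
    · intro a b hab hav hbv _ _ c hc hcab
      obtain ⟨g1, g2, g3⟩ := hopen _ hc
      -- An end where `φ₃` is at least `φ₃ c` would lie in the triangle by `hC` and be farther from
      -- `xy` than `w`; but every edge through `c` has such an end.
      have hz : ∀ z z', G.Adj z z' → z ≠ v → z' ≠ v → c ∈ segment ℝ (π.pos z) (π.pos z') →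
          ¬ φ₃ c ≤ φ₃ (π.pos z) := by
        intro z z' hzz hzv hzv' hcz hle
        have hmem := hC z z' c hzz hzv hzv' hcz g1 g2 (by linarith) hle (Or.inl (by linarith))
        have hzW : z ∈ W := by
          refine Finset.mem_filter.2 ⟨Finset.mem_univ _, hmem, hzv, ?_, ?_⟩
          · rintro rfl; linarith
          · rintro rfl; linarith
        have := hmax z hzW
        linarith
      have ha := not_le.1 (hz a b hab hav hbv hcab)
      have hb := not_le.1 (hz b a hab.symm hbv hav (by rwa [segment_symm]))
      obtain ⟨t, ht0, ht1, ht⟩ := mem_segment_iff.1 hcab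
      have := comb₃ (π.pos a) (π.pos b) t
      rw [← ht] at this
      rcases eq_or_lt_of_le ht0 with rfl | ht0
      · linarith
      · nlinarith
  refine ⟨hvx, ?_, hvy.symm, hpos, hempty⟩
  -- Now `x` sees `y`: an edge crossing `xy` either starts at `v`, and then runs in the open sector,
  -- or by `hC` has an end in the empty triangle.
  have hxy : x ≠ y := by rintro rfl; simp [hH] at hpos
  have hopen : ∀ c ∈ openSegment ℝ (π.pos x) (π.pos y), 0 < φ₁ c ∧ 0 < φ₂ c ∧ φ₃ c = 0 := by
    intro c hc
    obtain ⟨s, hs0, hs1, rfl⟩ := mem_openSegment_iff.1 hc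
    rw [comb₁, comb₂, comb₃, x1, x2, x3, y1, y2, y3]
    refine ⟨by nlinarith, by nlinarith, by ring⟩
  refine π.adj_of_visible' hG hxy ?_ ?_
  · intro z hz
    obtain ⟨g1, g2, g3⟩ := hopen _ hz
    rcases hempty z ⟨g1.le, g3.ge, g2.le⟩ with rfl | rfl | rfl <;> linarith
  · intro a b hab hax hbx hay hby c hc hcab
    obtain ⟨g1, g2, g3⟩ := hopen _ hc
    have hcba : c ∈ segment ℝ (π.pos b) (π.pos a) := by rwa [segment_symm]
    have hv : ∀ z, G.Adj v z → c ∉ segment ℝ (π.pos v) (π.pos z) := by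
      intro z hvz hcz
      obtain ⟨t, ht0, ht1, ht⟩ := mem_segment_iff.1 hcz
      have e1 := comb₁ (π.pos v) (π.pos z) t
      have e2 := comb₂ (π.pos v) (π.pos z) t
      rw [← ht, v1, mul_zero, zero_add] at e1
      rw [← ht, v2, mul_zero, zero_add] at e2
      exact hsec z hvz ⟨pos_of_mul_pos_right (e1 ▸ g1) ht0, pos_of_mul_pos_right (e2 ▸ g2) ht0⟩
    by_cases hav : a = v
    · subst hav; exact hv b hab hcab
    by_cases hbv : b = v
    · subst hbv; exact hv a hab.symm hcba
    obtain ⟨t, ht0, ht1, ht⟩ := mem_segment_iff.1 hcab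
    have := comb₃ (π.pos a) (π.pos b) t
    rw [← ht, g3] at this
    by_cases ha : 0 ≤ φ₃ (π.pos a)
    · rcases hempty a (hC a b c hab hav hbv hcab g1 g2 g3.ge (by rwa [g3])
        (Or.inr ⟨hax, hbx, hay, hby⟩)) with h | h | h
      exacts [hav h, hax h, hay h]
    · have hb : 0 ≤ φ₃ (π.pos b) := by
        by_contra hb
        rw [not_le] at ha hb
        rcases eq_or_lt_of_le ht0 with rfl | ht0
        · linarith
        · nlinarith
      rcases hempty b (hC b a c hab.symm hbv hav hcba g1 g2 g3.ge (by rwa [g3])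
        (Or.inr ⟨hbx, hax, hby, hay⟩)) with h | h | h
      exacts [hbv h, hbx h, hby h]

/-- Every point of the outer triangle off the drawing lies in an empty triangle. -/
theorem exists_isEmptyTri [Fintype V] (hG : IsMaximalPlanar G) {a b c : V}
    (habc : 0 < orient (π.pos a) (π.pos b) (π.pos c)) {p : Plane}
    (hp : p ∈ openTri (π.pos a) (π.pos b) (π.pos c)) (hps : p ∉ π.support) :
    ∃ v x y, π.IsEmptyTri v x y ∧ p ∈ openTri (π.pos v) (π.pos x) (π.pos y) := by
  classical
  have hseg : ∀ u v, G.Adj u v → p ∉ segment ℝ (π.pos u) (π.pos v) :=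
    fun u v huv h => hps (π.segment_subset_support huv h)
  have hnp : ∀ z, π.pos z ≠ p := fun z h => hps (h ▸ π.pos_mem_support z)
  have hbary : ∀ x y, 0 < orient x y p → ∃ w, 0 < orient x y (π.pos w) := by
    intro x y h
    by_contra! hcon
    have h1 := orient_bary (π.pos a) (π.pos b) (π.pos c) x y p
    have h2 := mul_nonneg hp.1.le (neg_nonneg.2 (hcon c))
    have h3 := mul_nonneg hp.2.1.le (neg_nonneg.2 (hcon a))
    have h4 := mul_nonneg hp.2.2.le (neg_nonneg.2 (hcon b))
    have h5 := mul_pos habc h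
    linarith
  obtain ⟨v, -, hvis1, hvis2⟩ := π.exists_visible (p := p) (fun u v huv _ _ => hseg u v huv)
    (π.pos a) (π.pos b) c (by
      have := orient_sum (π.pos a) (π.pos b) (π.pos c) p
      linarith [hp.2.1, hp.2.2])
  have hfree : ∀ q ∈ openSegment ℝ p (π.pos v), q ∉ π.support := by
    rintro q hq (⟨z, rfl⟩ | ⟨u, w, huw, hquw⟩)
    · exact hvis1 z hq
    · exact hvis2 u w huw (hnp u) (hnp w) q hq hquw
  -- As `p` is interior to `abc`, the corners cannot all lie on one closed side of the line `pv`
  -- unless all three lie on that line.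
  have hright : ∃ w, 0 < orient p (π.pos v) (π.pos w) := by
    by_contra! hcon
    obtain ⟨r, hr⟩ := exists_orient_pos (hnp v).symm
    have h1 := orient_bary (π.pos a) (π.pos b) (π.pos c) p (π.pos v) p
    rw [orient_self_left, mul_zero] at h1
    have h2 := mul_nonneg hp.1.le (neg_nonneg.2 (hcon c))
    have h3 := mul_nonneg hp.2.1.le (neg_nonneg.2 (hcon a))
    have h4 := mul_nonneg hp.2.2.le (neg_nonneg.2 (hcon b))
    have e1 : orient p (π.pos v) (π.pos a) = 0 :=
      (mul_eq_zero.1 (show _ * _ = (0 : ℝ) by linarith)).resolve_left hp.2.1.ne'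
    have e2 : orient p (π.pos v) (π.pos b) = 0 :=
      (mul_eq_zero.1 (show _ * _ = (0 : ℝ) by linarith)).resolve_left hp.2.2.ne'
    have e3 : orient p (π.pos v) (π.pos c) = 0 :=
      (mul_eq_zero.1 (show _ * _ = (0 : ℝ) by linarith)).resolve_left hp.1.ne'
    have h5 := orient_bary (π.pos a) (π.pos b) (π.pos c) p (π.pos v) r
    rw [e1, e2, e3] at h5
    have := mul_pos habc hr
    linarith
  obtain ⟨w₁, hw₁⟩ := hright
  obtain ⟨x₀, hvx₀, hx₀⟩ := π.exists_neighbor hG v p (π.pos v) w₁ (by simpa using hw₁)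
  rw [orient_self_right] at hx₀
  -- Around `v`, `x` is the first neighbour clockwise from `p`, and `y` below is the first one
  -- counterclockwise from `x`.
  obtain ⟨x, hx, hxmin⟩ := exists_angular_min
    (Finset.univ.filter fun x => G.Adj v x ∧ 0 < orient p (π.pos v) (π.pos x))
    ⟨x₀, by simpa using ⟨hvx₀, hx₀⟩⟩ π.pos (π.pos v) p (-1) (by
      intro w hw
      have := (Finset.mem_filter.1 hw).2.2
      rw [orient_swap']
      linarith)
  obtain ⟨hvx, hxp⟩ := (Finset.mem_filter.1 hx).2
  have hxp' : 0 < orient (π.pos v) (π.pos x) p := by rwa [orient_rotate]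
  obtain ⟨w₂, hw₂⟩ := hbary _ _ hxp'
  obtain ⟨y₀, hvy₀, hy₀⟩ := π.exists_neighbor hG v (π.pos v) (π.pos x) w₂ (by simpa using hw₂)
  rw [orient_self_left] at hy₀
  obtain ⟨y, hy, hymin⟩ := exists_angular_min
    (Finset.univ.filter fun y => G.Adj v y ∧ 0 < orient (π.pos v) (π.pos x) (π.pos y))
    ⟨y₀, by simpa using ⟨hvy₀, hy₀⟩⟩ π.pos (π.pos v) (π.pos x) 1 (by
      intro w hw
      rw [one_mul]
      exact (Finset.mem_filter.1 hw).2.2)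
  obtain ⟨hvy, hxy⟩ := (Finset.mem_filter.1 hy).2
  have htri := π.isEmptyTri_of_sector hG hvx hvy hxy (by
    rintro z hvz ⟨hz1, hz2⟩
    have := hymin z (by simpa using ⟨hvz, hz1⟩)
    rw [← orient_rotate, orient_swap] at hz2
    linarith)
  -- The neighbour `y` comes after `p`: on the ray `vp` it would block the view, equal `p`, or put
  -- `p` on an edge; before that ray it would have been chosen instead of `x`.
  have hyp : 0 < orient (π.pos y) (π.pos v) p := by
    by_contra hcon
    rcases eq_or_lt_of_le (not_lt.1 hcon) with h0 | hneg
    · obtain ⟨s, hs⟩ := exists_comb_of_orient_eq_zero (x := π.pos v) (y := p) (w := π.pos y) (hnp v)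
        ((orient_rotate _ _ _).trans h0)
      have e := orient_comb (π.pos v) (π.pos x) (π.pos v) p s
      rw [← hs, orient_self_left, mul_zero, zero_add] at e
      have hs0 : 0 < s := by
        by_contra hs0
        have := mul_nonneg (neg_nonneg.2 (not_lt.1 hs0)) hxp'.le
        linarith
      rcases lt_trichotomy s 1 with h | h | h
      · refine hvis1 y ?_
        rw [openSegment_symm]
        exact mem_openSegment_iff.2 ⟨s, hs0, h, hs⟩
      · rw [h] at hs; exact hnp y (by simpa using hs)
      · refine hseg v y hvy (mem_segment_iff.2 ⟨1 / s, by positivity, ?_, ?_⟩)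
        · rw [div_le_one hs0]; exact h.le
        · have hs0' : s ≠ 0 := hs0.ne'
          rw [hs]; apply plane_ext <;>
            simp only [PiLp.add_apply, PiLp.smul_apply, smul_eq_mul] <;> field_simp <;> ring
    · have hyx : 0 < orient p (π.pos v) (π.pos y) := by
        rw [← orient_rotate p, orient_swap']; linarith
      have := hxmin y (by simpa using ⟨hvy, hyx⟩)
      linarith
  refine ⟨v, x, y, htri, hxp', ?_, hyp⟩
  by_contra hcon
  have hsum := orient_sum (π.pos v) (π.pos x) (π.pos y) p
  have hv3 : orient (π.pos x) (π.pos y) (π.pos v) = orient (π.pos v) (π.pos x) (π.pos y) :=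
    orient_rotate _ _ _
  set H := orient (π.pos v) (π.pos x) (π.pos y)
  have hd : 0 < H - orient (π.pos x) (π.pos y) p := by linarith
  -- The parameter at which the segment from `v` to `p` reaches the line `xy`. That point is on the
  -- edge `xy`, so it blocks the view or is `p` itself.
  set t := H / (H - orient (π.pos x) (π.pos y) p) with ht
  have ht0 : 0 < t := div_pos hxy hd
  have ht1 : t ≤ 1 := by rw [ht, div_le_one hd]; linarith
  have htd : t * (H - orient (π.pos x) (π.pos y) p) = H := div_mul_cancel₀ _ hd.ne'
  obtain ⟨q, hq⟩ : ∃ q, q = (1 - t) • π.pos v + t • p := ⟨_, rfl⟩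
  have hq3 : orient (π.pos x) (π.pos y) q = 0 := by
    rw [hq, orient_comb, hv3]; linarith
  have hqs : q ∈ segment ℝ (π.pos x) (π.pos y) := by
    refine mem_segment_of_orient (by rwa [hv3]) hq3 ?_ ?_ <;> rw [hq, orient_comb]
    · simp only [orient_self_right, mul_zero, zero_add]; positivity
    · simp only [orient_self_left, mul_zero, zero_add]; positivity
  have hqsup := π.segment_subset_support htri.2.1 hqs
  rcases eq_or_lt_of_le ht1 with h | h
  · rw [h] at hq
    exact hps (by simpa [hq] using hqsup)
  · refine hfree q ?_ hqsup
    rw [openSegment_symm]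
    exact mem_openSegment_iff.2 ⟨t, ht0, h, hq⟩

end StraightLineDrawing

/-! ### Faces as components, and their triangles. -/

theorem mem_or_mem_frontier_of_mem_closure {F : Set Plane} {p : Plane} (hp : p ∈ closure F) :
    p ∈ F ∨ p ∈ frontier F := by
  rwa [closure_eq_self_union_frontier] at hp

theorem closedTri_subset_of_convex {a b c : Plane} (h : 0 < orient a b c) {S : Set Plane}
    (hS : Convex ℝ S) (ha : a ∈ S) (hb : b ∈ S) (hc : c ∈ S) : closedTri a b c ⊆ S := by
  rintro p ⟨h1, h2, h3⟩
  have hs := orient_sum a b c p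
  have hb' := bary_point a b c p
  have hp : p = (orient b c p / orient a b c) • a + (orient c a p / orient a b c) • b +
      (orient a b p / orient a b c) • c := by
    rw [← smul_right_inj h.ne', hb']
    simp only [smul_add, smul_smul, mul_div_cancel₀ _ h.ne']
  have := hS.sum_mem (t := Finset.univ) (w := ![orient b c p / orient a b c,
    orient c a p / orient a b c, orient a b p / orient a b c]) (z := ![a, b, c]) (by
      intro i _; fin_cases i <;> simp <;> positivity) (by
      simp only [Fin.sum_univ_three, Matrix.cons_val_zero, Matrix.cons_val_one, Matrix.cons_val]
      field_simp; linarith) (by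
      intro i _; fin_cases i <;> simpa)
  simp only [Fin.sum_univ_three, Matrix.cons_val_zero, Matrix.cons_val_one, Matrix.cons_val] at this
  rwa [hp]

theorem closure_openTri {a b c : Plane} (h : 0 < orient a b c) :
    closure (openTri a b c) = closedTri a b c := by
  obtain ⟨o, ho⟩ := exists_mem_openTri h
  exact (closure_minimal (openTri_subset_closedTri a b c) (isClosed_closedTri a b c)).antisymm
    fun p hp => side_subset_closure_openTri ho hp

theorem mem_closure_compl_closedTri {a b c p : Plane} (h : 0 < orient a b c)
    (hp : p ∈ closedTri a b c) (hp' : p ∉ openTri a b c) : p ∈ closure (closedTri a b c)ᶜ := by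
  rcases mem_side_of_mem_closedTri h hp hp' with hs | hs | hs
  · exact side_subset_closure_compl h hs
  · rw [← closedTri_rotate]
    exact side_subset_closure_compl (by rwa [orient_rotate]) hs
  · rw [← closedTri_rotate, ← closedTri_rotate]
    exact side_subset_closure_compl (by rwa [orient_rotate, orient_rotate]) hs

/-- An open preconnected set that avoids `S` and whose frontier lies in `S` is a connected component
of the complement of `S`. -/
theorem connectedComponentIn_compl_eq {U S : Set Plane} (hU : IsOpen U) (hpre : IsPreconnected U)
    (hUS : Disjoint U S) (hfr : frontier U ⊆ S) {p : Plane} (hp : p ∈ U) :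
    connectedComponentIn Sᶜ p = U := by
  have hUS' : U ⊆ Sᶜ := hUS.subset_compl_right
  refine Set.Subset.antisymm ?_ (hpre.subset_connectedComponentIn hp hUS')
  refine isPreconnected_connectedComponentIn.subset_left_of_subset_union hU
    isClosed_closure.isOpen_compl (Set.disjoint_compl_right_iff_subset.2 subset_closure) ?_
    ⟨p, mem_connectedComponentIn (hUS' hp), hp⟩
  intro q hq
  by_cases hqU : q ∈ U
  · exact Or.inl hqU
  · refine Or.inr fun hqc => connectedComponentIn_subset _ _ hq (hfr ?_)
    rw [hU.frontier_eq]; exact ⟨hqc, hqU⟩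

theorem dense_orient_ne_zero {x y : Plane} (hxy : x ≠ y) : Dense {q | orient x y q ≠ 0} := by
  intro q
  obtain ⟨r, hr⟩ := exists_orient_pos hxy
  by_cases hq : orient x y q = 0
  · have hcont : Filter.Tendsto (fun t : ℝ => (1 - t) • q + t • r) (nhdsWithin 0 (Set.Ioi 0))
        (nhds q) := by
      have : Continuous (fun t : ℝ => (1 - t) • q + t • r) := by fun_prop
      have h2 := this.tendsto 0
      simp only [sub_zero, one_smul, zero_smul, add_zero] at h2
      exact h2.mono_left nhdsWithin_le_nhds
    refine mem_closure_of_tendsto hcont ?_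
    filter_upwards [self_mem_nhdsWithin] with t ht
    have ht : 0 < t := ht
    show orient x y _ ≠ 0
    rw [orient_comb, hq]
    have := mul_pos ht hr
    intro h; linarith
  · exact subset_closure hq

namespace StraightLineDrawing

variable {V : Type*} {G : SimpleGraph V} (π : StraightLineDrawing G)

/-- The drawing is covered by the finitely many lines through two vertices. A second vertex is
needed for an isolated vertex to lie on such a line. -/
theorem dense_compl_support [Finite V] [Nontrivial V] : Dense π.supportᶜ := by
  have : Dense (⋂ e : {e : V × V // e.1 ≠ e.2}, {q | orient (π.pos e.1.1) (π.pos e.1.2) q ≠ 0}) :=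
    dense_iInter_of_isOpen
      (fun e => isOpen_ne_fun (continuous_orient _ _) continuous_const)
      (fun e => dense_orient_ne_zero (π.pos_injective.ne e.2))
  refine this.mono ?_
  rintro q hq (⟨w, rfl⟩ | ⟨u, v, huv, hs⟩)
  · obtain ⟨w', hw'⟩ := exists_ne w
    exact Set.mem_iInter.1 hq ⟨(w', w), hw'⟩ (by simp)
  · exact Set.mem_iInter.1 hq ⟨(u, v), huv.ne⟩ (orient_eq_zero_of_mem_segment hs)

/-- Three pairwise adjacent vertices in counterclockwise order. -/
def IsCcwClique (a b c : V) : Prop :=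
  G.Adj a b ∧ G.Adj b c ∧ G.Adj c a ∧ 0 < orient (π.pos a) (π.pos b) (π.pos c)

variable {π}

theorem IsCcwClique.mem_closedTri {a b c w : V} (h : π.IsCcwClique a b c)
    (hw : w ∈ ({a, b, c} : Set V)) : π.pos w ∈ closedTri (π.pos a) (π.pos b) (π.pos c) := by
  rcases hw with rfl | rfl | rfl
  exacts [left_mem_closedTri h.2.2.2, mid_mem_closedTri h.2.2.2, right_mem_closedTri h.2.2.2]

theorem IsCcwClique.exists_side {a b c : V} (h : π.IsCcwClique a b c) {p : Plane}
    (hp : p ∈ closedTri (π.pos a) (π.pos b) (π.pos c))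
    (hp' : p ∉ openTri (π.pos a) (π.pos b) (π.pos c)) :
    ∃ u v, u ∈ ({a, b, c} : Set V) ∧ v ∈ ({a, b, c} : Set V) ∧ G.Adj u v ∧
      p ∈ segment ℝ (π.pos u) (π.pos v) := by
  rcases mem_side_of_mem_closedTri h.2.2.2 hp hp' with hs | hs | hs
  · exact ⟨a, b, by simp, by simp, h.1, hs⟩
  · exact ⟨b, c, by simp, by simp, h.2.1, hs⟩
  · exact ⟨c, a, by simp, by simp, h.2.2.1, hs⟩

theorem not_mem_openTri_of_mem_segment {a b c u v : V} (hu : u ∈ ({a, b, c} : Set V))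
    (hv : v ∈ ({a, b, c} : Set V)) {p : Plane} (hp : p ∈ segment ℝ (π.pos u) (π.pos v)) :
    p ∉ openTri (π.pos a) (π.pos b) (π.pos c) := by
  obtain ⟨t, -, -, rfl⟩ := mem_segment_iff.1 hp
  rintro ⟨h1, h2, h3⟩
  rw [orient_comb] at h1 h2 h3
  rcases hu with rfl | rfl | rfl <;> rcases hv with rfl | rfl | rfl <;> simp at h1 h2 h3

/-- An edge that meets the interior of a triangle of the graph has its ends in that triangle. -/
theorem IsCcwClique.mem_closedTri_of_edge {a b c : V} (h : π.IsCcwClique a b c) {z z' : V}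
    (hzz : G.Adj z z') {q : Plane} (hq : q ∈ segment ℝ (π.pos z) (π.pos z'))
    (hq' : q ∈ openTri (π.pos a) (π.pos b) (π.pos c)) :
    π.pos z ∈ closedTri (π.pos a) (π.pos b) (π.pos c) := by
  by_contra hz
  obtain ⟨y, hy, hyc, hyo⟩ := exists_exit_tri hq' fun h => hz (openTri_subset_closedTri _ _ _ h)
  obtain ⟨u, v, hu, hv, huv, hyuv⟩ := h.exists_side hyc hyo
  have hyzz : y ∈ segment ℝ (π.pos z) (π.pos z') :=
    (convex_segment _ _).segment_subset hq (left_mem_segment _ _ _) hy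
  rcases π.meet (Or.inl hzz) (Or.inl huv) hyzz hyuv with he | ⟨w, rfl, hw, -⟩
  · refine not_mem_openTri_of_mem_segment (π := π) hu hv ?_ hq'
    rcases Sym2.eq_iff.1 he with ⟨rfl, rfl⟩ | ⟨rfl, rfl⟩
    · exact hq
    · rwa [segment_symm]
  · rcases hw with rfl | rfl
    · exact hz hyc
    -- The exit point is the far end `z'`, reached on the way from `q` to `z`, although `q` lies
    -- between `z` and `z'`. So `q` is that end, which is not interior.
    · rw [mem_segment_iff_wbtw] at hy hq
      have : q = π.pos w := (wbtw_swap_left_iff ℝ (π.pos z)).1 ⟨hy, hq.symm⟩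
      exact hyo (this ▸ hq')

theorem IsEmptyTri.isCcwClique {a b c : V} (h : π.IsEmptyTri a b c) : π.IsCcwClique a b c :=
  ⟨h.1, h.2.1, h.2.2.1, h.2.2.2.1⟩

/-- An edge that enters the interior has both ends in the closed triangle, so both are corners and
the edge is a side. -/
theorem IsEmptyTri.disjoint_support {a b c : V} (h : π.IsEmptyTri a b c) :
    Disjoint (openTri (π.pos a) (π.pos b) (π.pos c)) π.support := by
  have hmem : ∀ w, π.pos w ∈ closedTri (π.pos a) (π.pos b) (π.pos c) → w ∈ ({a, b, c} : Set V) :=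
    fun w hw => by simpa using h.2.2.2.2 w hw
  rw [Set.disjoint_left]
  rintro q hq (⟨w, rfl⟩ | ⟨z, z', hzz, hqz⟩)
  · have := hmem w (openTri_subset_closedTri _ _ _ hq)
    exact not_mem_openTri_of_mem_segment (π := π) this this (left_mem_segment _ _ _) hq
  · exact not_mem_openTri_of_mem_segment (π := π)
      (hmem z (h.isCcwClique.mem_closedTri_of_edge hzz hqz hq))
      (hmem z' (h.isCcwClique.mem_closedTri_of_edge hzz.symm (by rwa [segment_symm]) hq)) hqz hq

variable (π) in
/-- `F` is the face of the drawing bounded by the triangle with vertex set `t`: either the open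
triangle, if it is empty, or the complement of the closed triangle, if nothing lies outside. -/
def FaceOf (t : Set V) (F : Set Plane) : Prop :=
  ∃ a b c, t = {a, b, c} ∧ π.IsCcwClique a b c ∧
    ((π.IsEmptyTri a b c ∧ F = openTri (π.pos a) (π.pos b) (π.pos c)) ∨
      ((∀ w, π.pos w ∈ closedTri (π.pos a) (π.pos b) (π.pos c)) ∧
        F = (closedTri (π.pos a) (π.pos b) (π.pos c))ᶜ))

namespace FaceOf

variable {t t' : Set V} {F F' : Set Plane}

theorem isOpen (h : π.FaceOf t F) : IsOpen F := by
  obtain ⟨a, b, c, rfl, -, ⟨-, rfl⟩ | ⟨-, rfl⟩⟩ := h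
  · exact isOpen_openTri _ _ _
  · exact (isClosed_closedTri _ _ _).isOpen_compl

theorem isPreconnected (h : π.FaceOf t F) : IsPreconnected F := by
  obtain ⟨a, b, c, rfl, hc, ⟨-, rfl⟩ | ⟨-, rfl⟩⟩ := h
  · exact (convex_openTri _ _ _).isPreconnected
  · exact isPreconnected_compl_closedTri hc.2.2.2

/-- This connectedness is the topological input to `not_separating`. -/
theorem isPreconnected_compl_closure (h : π.FaceOf t F) : IsPreconnected (closure F)ᶜ := by
  obtain ⟨a, b, c, rfl, hc, ⟨-, rfl⟩ | ⟨-, rfl⟩⟩ := h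
  · rw [closure_openTri hc.2.2.2]
    exact isPreconnected_compl_closedTri hc.2.2.2
  · rw [closure_compl, compl_compl]
    exact (convex_closedTri _ _ _).interior.isPreconnected

theorem nonempty (h : π.FaceOf t F) : F.Nonempty := by
  obtain ⟨a, b, c, rfl, hc, ⟨-, rfl⟩ | ⟨-, rfl⟩⟩ := h
  · exact exists_mem_openTri hc.2.2.2
  · rw [← closure_nonempty_iff]
    exact ⟨_, side_subset_closure_compl hc.2.2.2 (left_mem_segment _ _ _)⟩

theorem disjoint_support (h : π.FaceOf t F) : Disjoint F π.support := by
  obtain ⟨a, b, c, rfl, hc, ⟨he, rfl⟩ | ⟨ho, rfl⟩⟩ := h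
  · exact he.disjoint_support
  · rw [Set.disjoint_compl_left_iff_subset]
    rintro q (⟨w, rfl⟩ | ⟨u, v, -, hq⟩)
    · exact ho w
    · exact segment_subset_closedTri (ho u) (ho v) hq

theorem segment_subset_frontier (h : π.FaceOf t F) {u v : V} (hu : u ∈ t) (hv : v ∈ t) :
    segment ℝ (π.pos u) (π.pos v) ⊆ frontier F := by
  intro p hp
  rw [h.isOpen.frontier_eq]
  obtain ⟨a, b, c, rfl, hc, ⟨-, rfl⟩ | ⟨-, rfl⟩⟩ := h
  · rw [closure_openTri hc.2.2.2]
    exact ⟨segment_subset_closedTri (hc.mem_closedTri hu) (hc.mem_closedTri hv) hp,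
      not_mem_openTri_of_mem_segment hu hv hp⟩
  · have hp' := segment_subset_closedTri (hc.mem_closedTri hu) (hc.mem_closedTri hv) hp
    exact ⟨mem_closure_compl_closedTri hc.2.2.2 hp' (not_mem_openTri_of_mem_segment hu hv hp),
      fun h => h hp'⟩

theorem exists_edge_of_mem_frontier (h : π.FaceOf t F) {p : Plane} (hp : p ∈ frontier F) :
    ∃ u v, u ∈ t ∧ v ∈ t ∧ G.Adj u v ∧ p ∈ segment ℝ (π.pos u) (π.pos v) := by
  obtain ⟨a, b, c, rfl, hc, ⟨-, rfl⟩ | ⟨-, rfl⟩⟩ := h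
  · rw [(isOpen_openTri _ _ _).frontier_eq, closure_openTri hc.2.2.2] at hp
    exact hc.exists_side hp.1 hp.2
  · rw [frontier_compl, (isClosed_closedTri _ _ _).frontier_eq] at hp
    exact hc.exists_side hp.1 fun h =>
      hp.2 (interior_maximal (openTri_subset_closedTri _ _ _) (isOpen_openTri _ _ _) h)

theorem frontier_subset_support (h : π.FaceOf t F) : frontier F ⊆ π.support := by
  intro p hp
  obtain ⟨u, v, -, -, huv, hs⟩ := h.exists_edge_of_mem_frontier hp
  exact π.segment_subset_support huv hs

theorem eq_component (h : π.FaceOf t F) {p : Plane} (hp : p ∈ F) :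
    connectedComponentIn π.supportᶜ p = F :=
  connectedComponentIn_compl_eq h.isOpen h.isPreconnected h.disjoint_support
    h.frontier_subset_support hp

theorem mem_faces (h : π.FaceOf t F) : F ∈ π.faces := by
  obtain ⟨p, hp⟩ := h.nonempty
  exact ⟨p, Set.disjoint_left.1 h.disjoint_support hp, (h.eq_component hp).symm⟩

/-- A face thus determines its vertex triple. -/
theorem mem_iff (h : π.FaceOf t F) (w : V) : w ∈ t ↔ π.pos w ∈ frontier F := by
  constructor
  · exact fun hw => h.segment_subset_frontier hw hw (left_mem_segment _ _ _)
  · intro hw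
    obtain ⟨u, v, hu, hv, huv, hs⟩ := h.exists_edge_of_mem_frontier hw
    rcases π.eq_or_eq_of_pos_mem_segment u v w huv hs with rfl | rfl <;> assumption

theorem eq_of_eq (h : π.FaceOf t F) (h' : π.FaceOf t' F) : t = t' := by
  ext w; rw [h.mem_iff, h'.mem_iff]

theorem adj (h : π.FaceOf t F) {u v : V} (hu : u ∈ t) (hv : v ∈ t) (huv : u ≠ v) : G.Adj u v := by
  obtain ⟨a, b, c, rfl, ⟨h1, h2, h3, -⟩, -⟩ := h
  rcases hu with rfl | rfl | rfl <;> rcases hv with rfl | rfl | rfl <;>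
    first | exact absurd rfl huv | assumption | (apply SimpleGraph.Adj.symm; assumption)

theorem ncard (h : π.FaceOf t F) : t.ncard = 3 := by
  obtain ⟨a, b, c, rfl, ⟨h1, h2, h3, -⟩, -⟩ := h
  exact Set.ncard_eq_three.2 ⟨a, b, c, h1.ne, h3.ne.symm, h2.ne, rfl⟩

/-- Closures of faces with different triples meet only along common edges or in common vertices; the
latter case is `u = v`. -/
theorem exists_common (h : π.FaceOf t F) (h' : π.FaceOf t' F') (hne : t ≠ t') {p : Plane}
    (hp : p ∈ closure F) (hp' : p ∈ closure F') :
    ∃ u v, u ∈ t ∧ u ∈ t' ∧ v ∈ t ∧ v ∈ t' ∧ p ∈ segment ℝ (π.pos u) (π.pos v) := by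
  rcases mem_or_mem_frontier_of_mem_closure hp with hp | hp
  · have hs := Set.disjoint_left.1 h.disjoint_support hp
    have hpF' := (mem_or_mem_frontier_of_mem_closure hp').resolve_right
      fun h => hs (h'.frontier_subset_support h)
    have hF : F = F' := (h.eq_component hp).symm.trans (h'.eq_component hpF')
    subst hF
    exact absurd (h.eq_of_eq h') hne
  · have hs := h.frontier_subset_support hp
    have hpF' := (mem_or_mem_frontier_of_mem_closure hp').resolve_left fun h =>
      Set.disjoint_left.1 h'.disjoint_support h hs
    obtain ⟨u, v, hu, hv, huv, huvp⟩ := h.exists_edge_of_mem_frontier hp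
    obtain ⟨x, y, hx, hy, hxy, hxyp⟩ := h'.exists_edge_of_mem_frontier hpF'
    rcases π.meet (Or.inl huv) (Or.inl hxy) huvp hxyp with he | ⟨w, rfl, hw, hw'⟩
    · rcases Sym2.eq_iff.1 he with ⟨rfl, rfl⟩ | ⟨rfl, rfl⟩
      · exact ⟨u, v, hu, hx, hv, hy, huvp⟩
      · exact ⟨u, v, hu, hy, hv, hx, huvp⟩
    · have h1 : w ∈ t := by rcases hw with rfl | rfl <;> assumption
      have h2 : w ∈ t' := by rcases hw' with rfl | rfl <;> assumption
      exact ⟨w, w, h1, h2, h1, h2, left_mem_segment _ _ _⟩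

end FaceOf

variable (π) in
theorem finite_faceOf [Finite V] : {F | ∃ t, π.FaceOf t F}.Finite := by
  refine Set.Finite.subset ((Set.finite_range fun e : V × V × V =>
    openTri (π.pos e.1) (π.pos e.2.1) (π.pos e.2.2)).union (Set.finite_range fun e : V × V × V =>
    (closedTri (π.pos e.1) (π.pos e.2.1) (π.pos e.2.2))ᶜ)) ?_
  rintro F ⟨t, a, b, c, -, -, ⟨-, rfl⟩ | ⟨-, rfl⟩⟩
  · exact Or.inl ⟨(a, b, c), rfl⟩
  · exact Or.inr ⟨(a, b, c), rfl⟩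

variable (π) in
/-- The outer triangle is covered by empty triangles. -/
theorem exists_isEmptyTri_closed [Fintype V] [Nontrivial V] (hG : IsMaximalPlanar G) {a b c : V}
    (habc : 0 < orient (π.pos a) (π.pos b) (π.pos c)) {p : Plane}
    (hp : p ∈ closedTri (π.pos a) (π.pos b) (π.pos c)) :
    ∃ v x y, π.IsEmptyTri v x y ∧ p ∈ closedTri (π.pos v) (π.pos x) (π.pos y) := by
  have hcl : IsClosed (⋃ e ∈ {e : V × V × V | π.IsEmptyTri e.1 e.2.1 e.2.2},
      closedTri (π.pos e.1) (π.pos e.2.1) (π.pos e.2.2)) :=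
    (Set.toFinite _).isClosed_biUnion fun e _ => isClosed_closedTri _ _ _
  have hsub : closedTri (π.pos a) (π.pos b) (π.pos c) ⊆
      ⋃ e ∈ {e : V × V × V | π.IsEmptyTri e.1 e.2.1 e.2.2},
        closedTri (π.pos e.1) (π.pos e.2.1) (π.pos e.2.2) := by
    -- Points off the drawing are dense in the open triangle, and a finite union of closed triangles
    -- is closed.
    rw [← closure_openTri habc]
    refine closure_minimal (((π.dense_compl_support).open_subset_closure_inter
      (isOpen_openTri _ _ _)).trans (closure_minimal ?_ hcl)) hcl
    rintro q ⟨hq, hqs⟩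
    obtain ⟨v, x, y, h, hqv⟩ := π.exists_isEmptyTri hG habc hq hqs
    exact Set.mem_biUnion (show (v, x, y) ∈ {e : V × V × V | π.IsEmptyTri e.1 e.2.1 e.2.2} from h)
      (openTri_subset_closedTri _ _ _ hqv)
  obtain ⟨e, he, hpe⟩ := Set.mem_iUnion₂.1 (hsub hp)
  exact ⟨e.1, e.2.1, e.2.2, he, hpe⟩

variable (π) in
theorem exists_faceOf_closure [Fintype V] (hG : IsMaximalPlanar G) (hV : 3 < Fintype.card V)
    (p : Plane) : ∃ t F, π.FaceOf t F ∧ p ∈ closure F := by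
  have : Nontrivial V := Fintype.one_lt_card_iff_nontrivial.1 (by omega)
  obtain ⟨a, b, c, hab, hbc, hca, habc, hout⟩ := π.exists_outer_triangle hG hV
  by_cases hp : p ∈ closedTri (π.pos a) (π.pos b) (π.pos c)
  · obtain ⟨v, x, y, h, hpv⟩ := π.exists_isEmptyTri_closed hG habc hp
    exact ⟨_, _, ⟨v, x, y, rfl, h.isCcwClique, Or.inl ⟨h, rfl⟩⟩, by
      rwa [closure_openTri h.2.2.2.1]⟩
  · exact ⟨_, _, ⟨a, b, c, rfl, ⟨hab, hbc, hca, habc⟩, Or.inr ⟨hout, rfl⟩⟩, subset_closure hp⟩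

/-- With more than three vertices, a triangle bounds at most one face. -/
theorem FaceOf.unique [Fintype V] (hV : 3 < Fintype.card V) {t : Set V} {F F' : Set Plane}
    (h : π.FaceOf t F) (h' : π.FaceOf t F') : F = F' := by
  have hncard := h.ncard
  have key : ∀ {a b c a' b' c' : V}, ({a, b, c} : Set V) = {a', b', c'} → π.IsCcwClique a b c →
      π.IsCcwClique a' b' c' → closedTri (π.pos a) (π.pos b) (π.pos c) ⊆
        closedTri (π.pos a') (π.pos b') (π.pos c') := by
    intro a b c a' b' c' he hc hc'
    exact closedTri_subset_of_convex hc.2.2.2 (convex_closedTri _ _ _)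
      (hc'.mem_closedTri (he ▸ by simp)) (hc'.mem_closedTri (he ▸ by simp))
      (hc'.mem_closedTri (he ▸ by simp))
  -- If the inside and the outside of one triangle were both faces, there would be no vertex besides
  -- its three corners.
  have hbad : ∀ {a b c a' b' c' : V}, t = {a, b, c} → t = {a', b', c'} → π.IsCcwClique a b c →
      π.IsEmptyTri a' b' c' → (∀ w, π.pos w ∈ closedTri (π.pos a) (π.pos b) (π.pos c)) → False := by
    intro a b c a' b' c' he he' hc hc' hout
    have : t = Set.univ := by
      rw [Set.eq_univ_iff_forall]
      intro w
      rw [he']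
      simpa using hc'.2.2.2.2 w (key (he.symm.trans he') hc hc'.isCcwClique (hout w))
    rw [this, Set.ncard_univ, Nat.card_eq_fintype_card] at hncard
    omega
  obtain ⟨a, b, c, he, hc, hF⟩ := h
  obtain ⟨a', b', c', he', hc', hF'⟩ := h'
  have heq := (key (he.symm.trans he') hc hc').antisymm (key (he'.symm.trans he) hc' hc)
  rcases hF with ⟨h1, rfl⟩ | ⟨h1, rfl⟩ <;> rcases hF' with ⟨h2, rfl⟩ | ⟨h2, rfl⟩
  · have hfin : ∀ {a b c : V}, π.IsCcwClique a b c →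
        openTri (π.pos a) (π.pos b) (π.pos c) =
          interior (closedTri (π.pos a) (π.pos b) (π.pos c)) := by
      intro a b c hc
      refine (interior_maximal (openTri_subset_closedTri _ _ _) (isOpen_openTri _ _ _)).antisymm ?_
      intro p hp
      by_contra hpo
      have := mem_closure_compl_closedTri hc.2.2.2 (interior_subset hp) hpo
      rw [closure_compl] at this
      exact this hp
    rw [hfin hc, hfin hc', heq]
  · exact (hbad he' he hc' h1 h2).elim
  · exact (hbad he he' hc h2 h1).elim
  · rw [heq]

/-! ### Facial triangles do not depend on the drawing. -/

/-- A facial triangle does not separate the graph. -/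
theorem FaceOf.not_separating [Fintype V] (hG : IsMaximalPlanar G) (hV : 3 < Fintype.card V)
    {t : Set V} {F : Set Plane} (h : π.FaceOf t F) (χ : V → Prop)
    (hχ : ∀ u v, G.Adj u v → u ∉ t → v ∉ t → (χ u ↔ χ v)) {u v : V} (hu : u ∉ t) (hv : v ∉ t)
    (hχu : χ u) : χ v := by
  by_contra hχv
  -- Each face with triple other than `t` is coloured by `χ` at a vertex off `t`. If both colours
  -- occurred, the closures of the two classes would be closed sets covering the connected
  -- complement of `closure F`, and so would meet there.
  let 𝓤 : Prop → Set (Set Plane) := fun κ =>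
    {F' | ∃ t', π.FaceOf t' F' ∧ ∃ z ∈ t', z ∉ t ∧ (χ z ↔ κ)}
  have hcl : ∀ κ, IsClosed (⋃ F' ∈ 𝓤 κ, closure F') := by
    intro κ
    refine (π.finite_faceOf.subset ?_).isClosed_biUnion fun _ _ => isClosed_closure
    rintro F' ⟨t', ht', -⟩
    exact ⟨t', ht'⟩
  have hR : ∀ z, z ∉ t → π.pos z ∈ (closure F)ᶜ := by
    intro z hz hzF
    rcases mem_or_mem_frontier_of_mem_closure hzF with hz' | hz'
    · exact Set.disjoint_left.1 h.disjoint_support hz' (π.pos_mem_support z)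
    · exact hz ((h.mem_iff z).2 hz')
  have hcolor : ∀ z, z ∉ t → ∀ κ, (χ z ↔ κ) → π.pos z ∈ ⋃ F' ∈ 𝓤 κ, closure F' := by
    intro z hz κ hκ
    obtain ⟨t', F', h', hz'⟩ := π.exists_faceOf_closure hG hV (π.pos z)
    have hzt' : z ∈ t' := by
      rcases mem_or_mem_frontier_of_mem_closure hz' with h1 | h1
      · exact absurd (π.pos_mem_support z) (Set.disjoint_left.1 h'.disjoint_support h1)
      · exact (h'.mem_iff z).2 h1
    exact Set.mem_biUnion (show F' ∈ 𝓤 κ from ⟨t', h', z, hzt', hz, hκ⟩) hz'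
  obtain ⟨p, hpR, hp1, hp2⟩ := isPreconnected_closed_iff.1 h.isPreconnected_compl_closure _ _
    (hcl True) (hcl False) (by
      intro p hp
      obtain ⟨t', F', h', hp'⟩ := π.exists_faceOf_closure hG hV p
      have hne : t' ≠ t := by
        rintro rfl
        rw [h.unique hV h'] at hp
        exact hp hp'
      obtain ⟨z, hz, hzt⟩ : ∃ z ∈ t', z ∉ t := by
        by_contra! hcon
        exact hne (Set.eq_of_subset_of_ncard_le hcon (by rw [h.ncard, h'.ncard]))
      by_cases hc : χ z
      · exact Or.inl (Set.mem_biUnion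
          (show F' ∈ 𝓤 True from ⟨t', h', z, hz, hzt, by simpa using hc⟩) hp')
      · exact Or.inr (Set.mem_biUnion
          (show F' ∈ 𝓤 False from ⟨t', h', z, hz, hzt, by simpa using hc⟩) hp'))
    ⟨_, hR u hu, hcolor u hu True (by simpa using hχu)⟩
    ⟨_, hR v hv, hcolor v hv False (by simpa using hχv)⟩
  obtain ⟨F₁, ⟨t₁, h₁, z₁, hz₁, hz₁t, hc₁⟩, hpF₁⟩ := Set.mem_iUnion₂.1 hp1
  obtain ⟨F₂, ⟨t₂, h₂, z₂, hz₂, hz₂t, hc₂⟩, hpF₂⟩ := Set.mem_iUnion₂.1 hp2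
  have hall₁ : ∀ z ∈ t₁, z ∉ t → χ z := by
    intro z hz hzt
    by_cases he : z = z₁
    · rw [he]; simpa using hc₁
    · exact (hχ z z₁ (h₁.adj hz hz₁ he) hzt hz₁t).2 (by simpa using hc₁)
  have hall₂ : ∀ z ∈ t₂, z ∉ t → ¬ χ z := by
    intro z hz hzt
    by_cases he : z = z₂
    · rw [he]; simpa using hc₂
    · exact fun hχz => (by simpa using hc₂ : ¬ χ z₂)
        ((hχ z z₂ (h₂.adj hz hz₂ he) hzt hz₂t).1 hχz)
  have hne : t₁ ≠ t₂ := by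
    rintro rfl
    exact hall₂ z₁ hz₁ hz₁t (hall₁ z₁ hz₁ hz₁t)
  obtain ⟨x, y, hx1, hx2, hy1, hy2, hpxy⟩ := h₁.exists_common h₂ hne hpF₁ hpF₂
  -- A vertex shared by faces of opposite colours must be in `t`; so the meeting point lies on the
  -- frontier of `F`, outside the region considered.
  have hin : ∀ z, z ∈ t₁ → z ∈ t₂ → z ∈ t := by
    intro z hz1 hz2
    by_contra hzt
    exact hall₂ z hz2 hzt (hall₁ z hz1 hzt)
  exact hpR (frontier_subset_closure
    (h.segment_subset_frontier (hin x hx1 hx2) (hin y hy1 hy2) hpxy))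

/-- Of three collinear vertices the middle one would lie on the edge between the other two. -/
theorem orient_ne_zero_of_clique {a b c : V} (hab : G.Adj a b) (hbc : G.Adj b c)
    (hca : G.Adj c a) : orient (π.pos a) (π.pos b) (π.pos c) ≠ 0 := by
  intro h0
  have key : ∀ {x y z : V}, G.Adj x y → z ≠ x → z ≠ y →
      π.pos z ∉ segment ℝ (π.pos x) (π.pos y) := by
    intro x y z hxy hzx hzy hz
    rcases π.eq_or_eq_of_pos_mem_segment x y z hxy hz with h | h
    exacts [hzx h, hzy h]
  obtain ⟨s, hs⟩ := exists_comb_of_orient_eq_zero (π.pos_injective.ne hab.ne) h0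
  rcases lt_or_ge s 0 with h1 | h1
  · refine key hbc hab.ne hca.ne.symm (mem_segment_iff.2 ⟨1 / (1 - s),
      div_nonneg zero_le_one (by linarith), by rw [div_le_one] <;> linarith, ?_⟩)
    have : (1 : ℝ) - s ≠ 0 := by linarith
    rw [hs]; apply plane_ext <;> simp only [PiLp.add_apply, PiLp.smul_apply, smul_eq_mul] <;>
      field_simp <;> ring
  rcases le_or_gt s 1 with h2 | h2
  · exact key hab hca.ne hbc.ne.symm (mem_segment_iff.2 ⟨s, h1, h2, hs⟩)
  · refine key hca hbc.ne hab.ne.symm (mem_segment_iff.2 ⟨1 - 1 / s, ?_, ?_, ?_⟩)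
    · have : 1 / s ≤ 1 := by rw [div_le_one] <;> linarith
      linarith
    · have : 0 ≤ 1 / s := by positivity
      linarith
    have : s ≠ 0 := by linarith
    rw [hs]; apply plane_ext <;> simp only [PiLp.add_apply, PiLp.smul_apply, smul_eq_mul] <;>
      field_simp <;> ring

/-- The facial triangles of a maximal planar graph are the same in all drawings. -/
theorem FaceOf.transfer [Fintype V] (hG : IsMaximalPlanar G) (hV : 3 < Fintype.card V)
    {t : Set V} {F : Set Plane} (h : π.FaceOf t F) (ρ : StraightLineDrawing G) :
    ∃ F', ρ.FaceOf t F' := by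
  obtain ⟨a, b, c, ht, hc⟩ : ∃ a b c, t = {a, b, c} ∧ ρ.IsCcwClique a b c := by
    obtain ⟨a, b, c, rfl, ⟨hab, hbc, hca, -⟩, -⟩ := h
    rcases lt_or_gt_of_ne (orient_ne_zero_of_clique (π := ρ) hab hbc hca) with h | h
    · exact ⟨a, c, b, by rw [Set.pair_comm], hca.symm, hbc.symm, hab.symm, by
        rw [orient_swap]; linarith⟩
    · exact ⟨a, b, c, rfl, hab, hbc, hca, h⟩
  by_cases hemp : ∀ w, ρ.pos w ∈ closedTri (ρ.pos a) (ρ.pos b) (ρ.pos c) → w = a ∨ w = b ∨ w = c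
  · exact ⟨_, a, b, c, ht, hc, Or.inl ⟨⟨hc.1, hc.2.1, hc.2.2.1, hc.2.2.2, hemp⟩, rfl⟩⟩
  by_cases hout : ∀ w, ρ.pos w ∈ closedTri (ρ.pos a) (ρ.pos b) (ρ.pos c)
  · exact ⟨_, a, b, c, ht, hc, Or.inr ⟨hout, rfl⟩⟩
  exfalso
  push Not at hemp hout
  obtain ⟨w₁, hw₁, hw₁t⟩ := hemp
  obtain ⟨w₂, hw₂⟩ := hout
  -- In `ρ` no edge off `t` joins the inside of the triangle to the outside, so being inside is
  -- constant along edges off `t`. With vertices on both sides, this contradicts `not_separating`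
  -- for `π`.
  have hstep : ∀ u v, G.Adj u v → u ∉ t →
      ρ.pos u ∈ closedTri (ρ.pos a) (ρ.pos b) (ρ.pos c) →
      ρ.pos v ∈ closedTri (ρ.pos a) (ρ.pos b) (ρ.pos c) := by
    intro u v huv hut hu
    have huo : ρ.pos u ∈ openTri (ρ.pos a) (ρ.pos b) (ρ.pos c) := by
      by_contra huo
      obtain ⟨x, y, hx, hy, hxy, hs⟩ := hc.exists_side hu huo
      rw [← ht] at hx hy
      rcases ρ.eq_or_eq_of_pos_mem_segment x y u hxy hs with rfl | rfl
      exacts [hut hx, hut hy]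
    exact hc.mem_closedTri_of_edge huv.symm (right_mem_segment _ _ _) huo
  refine hw₂ (h.not_separating hG hV (fun w => ρ.pos w ∈ closedTri (ρ.pos a) (ρ.pos b) (ρ.pos c))
    (fun u v huv hu hv => ⟨hstep u v huv hu, hstep v u huv.symm hv⟩) (u := w₁) (v := w₂) ?_ ?_ hw₁)
  · rw [ht]; simpa using hw₁t
  · intro h2
    rw [ht] at h2
    exact hw₂ (hc.mem_closedTri h2)

end StraightLineDrawing

/-! ### Lines through no vertex and the faces they meet. -/

theorem isCompact_closedTri {a b c : Plane} (h : 0 < orient a b c) :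
    IsCompact (closedTri a b c) := by
  refine ((Set.toFinite {a, b, c}).isCompact_convexHull ℝ).of_isClosed_subset
    (isClosed_closedTri a b c) ?_
  refine closedTri_subset_of_convex h (convex_convexHull ℝ _) ?_ ?_ ?_ <;>
    exact subset_convexHull ℝ _ (by simp)

theorem mem_segment_line {p d : Plane} {r s x : ℝ} (h1 : r ≤ x) (h2 : x ≤ s) :
    p + x • d ∈ segment ℝ (p + r • d) (p + s • d) := by
  rcases eq_or_lt_of_le (h1.trans h2) with rfl | hlt
  · obtain rfl : x = r := le_antisymm h2 h1
    exact left_mem_segment _ _ _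
  · have hne : s - r ≠ 0 := (sub_pos.2 hlt).ne'
    refine mem_segment_iff.2 ⟨(x - r) / (s - r), div_nonneg (by linarith) (by linarith),
      (div_le_one (by linarith)).2 (by linarith), ?_⟩
    apply plane_ext <;> simp only [PiLp.add_apply, PiLp.smul_apply, smul_eq_mul] <;> field_simp <;>
      ring

theorem exists_of_mem_segment_line {p d : Plane} {r s : ℝ} (hrs : r ≤ s) {y : Plane}
    (hy : y ∈ segment ℝ (p + r • d) (p + s • d)) : ∃ x, r ≤ x ∧ x ≤ s ∧ y = p + x • d := by
  obtain ⟨t, ht0, ht1, rfl⟩ := mem_segment_iff.1 hy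
  exact ⟨(1 - t) * r + t * s, by nlinarith, by nlinarith, by module⟩

/-- A line that meets a bounded set leaves it in both directions. -/
theorem exists_exit_line {S : Set Plane} (hS : IsCompact S) {p d : Plane} (hd : d ≠ 0) (s : ℝ) :
    ∃ r, s < r ∧ p + r • d ∉ S := by
  obtain ⟨R, hR⟩ := hS.isBounded.subset_closedBall p
  have hd' : 0 < ‖d‖ := norm_pos_iff.2 hd
  refine ⟨max (s + 1) ((|R| + 1) / ‖d‖), lt_max_of_lt_left (by linarith), fun hmem => ?_⟩
  have h1 := hR hmem
  rw [Metric.mem_closedBall, dist_self_add_left, norm_smul, Real.norm_eq_abs] at h1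
  have h2 : (|R| + 1) / ‖d‖ ≤ |max (s + 1) ((|R| + 1) / ‖d‖)| :=
    (le_max_right _ _).trans (le_abs_self _)
  rw [div_le_iff₀ hd'] at h2
  linarith [le_abs_self R]

namespace StraightLineDrawing

variable {V : Type*} {G : SimpleGraph V} {π : StraightLineDrawing G}

/-- A line through no vertex meets each edge at most once. -/
theorem line_meets_edge_once {p d : Plane} (hd : d ≠ 0) (hv : ∀ w (s : ℝ), π.pos w ≠ p + s • d)
    {u v : V} {s s' : ℝ} (h : p + s • d ∈ segment ℝ (π.pos u) (π.pos v))
    (h' : p + s' • d ∈ segment ℝ (π.pos u) (π.pos v)) : s = s' := by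
  by_contra hne
  obtain ⟨t, -, -, ht⟩ := mem_segment_iff.1 h
  obtain ⟨t', -, -, ht'⟩ := mem_segment_iff.1 h'
  have e : (s - s') • d = (t - t') • (π.pos v - π.pos u) := by
    calc (s - s') • d = (p + s • d) - (p + s' • d) := by module
      _ = (t - t') • (π.pos v - π.pos u) := by rw [ht, ht']; module
  have htt : t - t' ≠ 0 := by
    intro h0
    rw [h0, zero_smul, smul_eq_zero] at e
    rcases e with e | e
    · exact hne (sub_eq_zero.1 e)
    · exact hd e
  have e2 : π.pos v - π.pos u = ((t - t')⁻¹ * (s - s')) • d := by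
    rw [mul_smul, e, inv_smul_smul₀ htt]
  refine hv u (s - t * ((t - t')⁻¹ * (s - s'))) ?_
  calc π.pos u = ((1 - t) • π.pos u + t • π.pos v) - t • (π.pos v - π.pos u) := by module
    _ = (p + s • d) - t • (((t - t')⁻¹ * (s - s')) • d) := by rw [← ht, e2]
    _ = _ := by module

theorem finite_line_inter_support [Finite V] {p d : Plane} (hd : d ≠ 0)
    (hv : ∀ w (s : ℝ), π.pos w ≠ p + s • d) : {s : ℝ | p + s • d ∈ π.support}.Finite := by
  refine Set.Finite.subset (Set.finite_iUnion fun e : V × V => Set.Subsingleton.finite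
    (s := {s : ℝ | p + s • d ∈ segment ℝ (π.pos e.1) (π.pos e.2)})
    fun s hs s' hs' => line_meets_edge_once hd hv hs hs') ?_
  rintro s (⟨w, hw⟩ | ⟨u, v, -, hs⟩)
  · exact absurd hw (hv w s)
  · exact Set.mem_iUnion.2 ⟨(u, v), hs⟩

/-- If an open stretch of a line through no vertex lies in a face and ends in a point of the
drawing, this point is on the frontier of that face. -/
theorem mem_frontier_of_gap {p d : Plane} {t : Set V} {F : Set Plane} (hF : π.FaceOf t F)
    {x y z : ℝ} (hxy : x < y) (hz : z = x ∨ z = y) (hs : p + z • d ∈ π.support)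
    (hgap : ∀ s ∈ Set.Ioo x y, p + s • d ∈ F) : p + z • d ∈ frontier F := by
  have hzc : z ∈ closure (Set.Ioo x y) := by
    rw [closure_Ioo hxy.ne]
    rcases hz with rfl | rfl
    · exact Set.left_mem_Icc.2 hxy.le
    · exact Set.right_mem_Icc.2 hxy.le
  have hcont : Continuous fun s : ℝ => p + s • d := by fun_prop
  have hcl : p + z • d ∈ closure F :=
    map_mem_closure (f := fun s : ℝ => p + s • d) hcont hzc hgap
  exact (mem_or_mem_frontier_of_mem_closure hcl).resolve_left
    fun h => Set.disjoint_left.1 hF.disjoint_support h hs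

/-- The crossing point is not a vertex, so the edges through it on the two frontiers coincide. -/
theorem exists_common_edge {p d : Plane} (hv : ∀ w (s : ℝ), π.pos w ≠ p + s • d) {t t' : Set V}
    {F F' : Set Plane} (h : π.FaceOf t F) (h' : π.FaceOf t' F') {s : ℝ}
    (hs : p + s • d ∈ frontier F) (hs' : p + s • d ∈ frontier F') :
    ∃ u v, G.Adj u v ∧ u ∈ t ∧ v ∈ t ∧ u ∈ t' ∧ v ∈ t' ∧
      p + s • d ∈ segment ℝ (π.pos u) (π.pos v) := by
  obtain ⟨u, v, hu, hv', huv, h1⟩ := h.exists_edge_of_mem_frontier hs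
  obtain ⟨x, y, hx, hy, hxy, h2⟩ := h'.exists_edge_of_mem_frontier hs'
  rcases π.meet (Or.inl huv) (Or.inl hxy) h1 h2 with he | ⟨w, hw, -⟩
  · rcases Sym2.eq_iff.1 he with ⟨rfl, rfl⟩ | ⟨rfl, rfl⟩
    · exact ⟨u, v, huv, hu, hv', hx, hy, h1⟩
    · exact ⟨u, v, huv, hu, hv', hy, hx, h1⟩
  · exact absurd hw.symm (hv w s)

/-- The faces met by a line through no vertex, in their order along the line. -/
theorem exists_cyclic_faces [Fintype V] (hG : IsMaximalPlanar G) (hV : 3 < Fintype.card V)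
    {a b c : V} (hc : π.IsCcwClique a b c)
    (hout : ∀ w, π.pos w ∈ closedTri (π.pos a) (π.pos b) (π.pos c)) {p d : Plane} (hd : d ≠ 0)
    (hv : ∀ w (s : ℝ), π.pos w ≠ p + s • d) {s₀ : ℝ}
    (hs₀ : p + s₀ • d ∈ openTri (π.pos a) (π.pos b) (π.pos c)) :
    ∃ (n : ℕ) (τ : Fin (n + 3) → Set V), Function.Injective τ ∧ (∀ i, ∃ F, π.FaceOf (τ i) F) ∧
      (∀ i, ∃ u v, G.Adj u v ∧ u ∈ τ i ∧ v ∈ τ i ∧ u ∈ τ (i + 1) ∧ v ∈ τ (i + 1)) ∧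
      ∀ s : ℝ, p + s • d ∉ π.support → ∃ i F, π.FaceOf (τ i) F ∧ p + s • d ∈ F := by
  classical
  set T := closedTri (π.pos a) (π.pos b) (π.pos c) with hT
  set O := openTri (π.pos a) (π.pos b) (π.pos c) with hO
  have hface : π.FaceOf {a, b, c} Tᶜ := ⟨a, b, c, rfl, hc, Or.inr ⟨hout, rfl⟩⟩
  have hsupT : π.support ⊆ T := by
    have := hface.disjoint_support
    rwa [Set.disjoint_compl_left_iff_subset] at this
  have hTO : ∀ q ∈ T, q ∉ π.support → q ∈ O := by
    intro q hq hqs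
    by_contra hqO
    obtain ⟨u, v, -, -, huv, hs⟩ := hc.exists_side hq hqO
    exact hqs (π.segment_subset_support huv hs)
  have hTc : IsCompact T := isCompact_closedTri hc.2.2.2
  let P : Set ℝ := {s : ℝ | p + s • d ∈ π.support}
  have hP : P.Finite := finite_line_inter_support hd hv
  have hinj : ∀ x x' : ℝ, p + x • d = p + x' • d → x = x' := by
    intro x x' he
    have : (x - x') • d = 0 := by
      calc (x - x') • d = (p + x • d) - (p + x' • d) := by module
        _ = 0 := by rw [he, sub_self]
    exact sub_eq_zero.1 ((smul_eq_zero.1 this).resolve_right hd)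
  have hexit : ∀ r r' : ℝ, p + r • d ∈ O → p + r' • d ∉ T →
      ∃ x ∈ P, x ≠ r ∧ p + x • d ∈ segment ℝ (p + r • d) (p + r' • d) := by
    intro r r' hr hr'
    obtain ⟨y, hy, hyT, hyO⟩ := exists_exit_tri hr
      (fun h => hr' (openTri_subset_closedTri _ _ _ h))
    have hyS : y ∈ π.support := by
      by_contra h
      exact hyO (hTO y hyT h)
    obtain ⟨t, -, -, ht⟩ := mem_segment_iff.1 hy
    obtain ⟨x, rfl⟩ : ∃ x : ℝ, y = p + x • d := ⟨(1 - t) * r + t * r', by rw [ht]; module⟩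
    exact ⟨_, hyS, fun h => hyO (h ▸ hr), hy⟩
  have hright : ∀ r : ℝ, p + r • d ∈ O → ∃ x ∈ P, r < x := by
    intro r hr
    obtain ⟨r', hlt, hr'⟩ := exists_exit_line hTc (p := p) hd r
    obtain ⟨x, hx, hne, hseg⟩ := hexit r r' hr hr'
    obtain ⟨x', h1, h2, he⟩ := exists_of_mem_segment_line hlt.le hseg
    rw [← hinj x x' he] at h1
    exact ⟨x, hx, lt_of_le_of_ne h1 hne.symm⟩
  have hleft : ∀ r : ℝ, p + r • d ∈ O → ∃ x ∈ P, x < r := by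
    intro r hr
    obtain ⟨r', hlt, hr'⟩ := exists_exit_line hTc (p := p) (neg_ne_zero.2 hd) (-r)
    obtain ⟨x, hx, hne, hseg⟩ := hexit r (-r') hr (by rwa [neg_smul, ← smul_neg])
    rw [segment_symm] at hseg
    obtain ⟨x', h1, h2, he⟩ := exists_of_mem_segment_line (by linarith) hseg
    rw [← hinj x x' he] at h2
    exact ⟨x, hx, lt_of_le_of_ne h2 hne⟩
  -- There are crossings on both sides of `s₀`. With `m + 2` crossings there are `m + 1` bounded
  -- gaps, which together with the outer face make `m + 2` places in the cyclic order.
  obtain ⟨m, hm⟩ : ∃ m, hP.toFinset.card = m + 2 := by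
    obtain ⟨x₁, hx₁, h1⟩ := hright s₀ hs₀
    obtain ⟨x₂, hx₂, h2⟩ := hleft s₀ hs₀
    have : 1 < hP.toFinset.card := Finset.one_lt_card.2
      ⟨x₁, hP.mem_toFinset.2 hx₁, x₂, hP.mem_toFinset.2 hx₂, (h2.trans h1).ne'⟩
    exact ⟨_, (Nat.sub_add_cancel this).symm⟩
  let x : Fin (m + 2) → ℝ := hP.toFinset.orderEmbOfFin hm
  have hxmono : StrictMono x := (hP.toFinset.orderEmbOfFin hm).strictMono
  have hxP : ∀ i, p + x i • d ∈ π.support := fun i =>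
    hP.mem_toFinset.1 (Finset.orderEmbOfFin_mem _ hm i)
  have hxall : ∀ s : ℝ, p + s • d ∈ π.support → ∃ i, x i = s := by
    intro s hs
    have : s ∈ Set.range (hP.toFinset.orderEmbOfFin hm) := by
      rw [Finset.range_orderEmbOfFin]; exact hP.mem_toFinset.2 hs
    exact this
  -- the faces in the bounded gaps
  have hgap : ∀ j : Fin (m + 1), ∃ A B C, π.IsEmptyTri A B C ∧
      ∀ s ∈ Set.Ioo (x j.castSucc) (x j.succ),
        p + s • d ∈ openTri (π.pos A) (π.pos B) (π.pos C) := by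
    intro j
    have hlt : x j.castSucc < x j.succ := hxmono Fin.castSucc_lt_succ
    have hns : ∀ s ∈ Set.Ioo (x j.castSucc) (x j.succ), p + s • d ∉ π.support := by
      rintro s ⟨h1, h2⟩ hs
      obtain ⟨i, rfl⟩ := hxall s hs
      rw [hxmono.lt_iff_lt] at h1 h2
      rw [Fin.lt_def] at h1 h2
      simp at h1 h2
      omega
    have hmid : (x j.castSucc + x j.succ) / 2 ∈ Set.Ioo (x j.castSucc) (x j.succ) :=
      ⟨by linarith, by linarith⟩
    have hmT : p + ((x j.castSucc + x j.succ) / 2) • d ∈ O :=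
      hTO _ (segment_subset_closedTri (hsupT (hxP _)) (hsupT (hxP _))
        (mem_segment_line hmid.1.le hmid.2.le)) (hns _ hmid)
    obtain ⟨A, B, C, hE, hmem⟩ := π.exists_isEmptyTri hG hc.2.2.2 hmT (hns _ hmid)
    refine ⟨A, B, C, hE, fun s hs => ?_⟩
    have hF : π.FaceOf {A, B, C} (openTri (π.pos A) (π.pos B) (π.pos C)) :=
      ⟨A, B, C, rfl, hE.isCcwClique, Or.inl ⟨hE, rfl⟩⟩
    -- The gap is connected and avoids the drawing, so it stays in the face of its midpoint.
    rw [← hF.eq_component hmem]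
    have hpre : IsPreconnected ((fun s : ℝ => p + s • d) '' Set.Ioo (x j.castSucc) (x j.succ)) :=
      isPreconnected_Ioo.image _ (by fun_prop)
    refine hpre.subset_connectedComponentIn ⟨_, hmid, rfl⟩ ?_ ⟨s, hs, rfl⟩
    rintro _ ⟨s, hs, rfl⟩
    exact hns s hs
  choose A B C hE hgapF using hgap
  have houtside : ∀ s : ℝ, p + s • d ∉ π.support → (s < x 0 ∨ x (Fin.last _) < s) →
      p + s • d ∈ Tᶜ := by
    intro s hs hor hsT
    have hsO := hTO _ hsT hs
    rcases hor with h | h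
    · obtain ⟨y, hy, hlt⟩ := hleft s hsO
      obtain ⟨i, rfl⟩ := hxall y hy
      exact absurd (hxmono.monotone (Fin.zero_le i)) (by linarith)
    · obtain ⟨y, hy, hlt⟩ := hright s hsO
      obtain ⟨i, rfl⟩ := hxall y hy
      exact absurd (hxmono.monotone (Fin.le_last i)) (by linarith)
  have hbefore : ∀ s, s < x 0 → p + s • d ∈ Tᶜ := by
    refine fun s h => houtside s (fun hs => ?_) (Or.inl h)
    obtain ⟨i, rfl⟩ := hxall s hs
    exact absurd (hxmono.monotone (Fin.zero_le i)) (by linarith)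
  have hafter : ∀ s, x (Fin.last _) < s → p + s • d ∈ Tᶜ := by
    refine fun s h => houtside s (fun hs => ?_) (Or.inr h)
    obtain ⟨i, rfl⟩ := hxall s hs
    exact absurd (hxmono.monotone (Fin.le_last i)) (by linarith)
  -- the cyclic sequence of faces; the `i`-th one precedes the `i`-th crossing
  let τ : Fin (m + 2) → Set V := Fin.cons {a, b, c} fun j => {A j, B j, C j}
  let Φ : Fin (m + 2) → Set Plane := Fin.cons Tᶜ fun j =>
    openTri (π.pos (A j)) (π.pos (B j)) (π.pos (C j))
  have hΦ : ∀ i, π.FaceOf (τ i) (Φ i) := by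
    intro i
    refine Fin.cases hface (fun j => ?_) i
    exact ⟨A j, B j, C j, rfl, (hE j).isCcwClique, Or.inl ⟨hE j, rfl⟩⟩
  have hpre : ∀ i, p + x i • d ∈ frontier (Φ i) := by
    intro i
    refine Fin.cases ?_ (fun j => ?_) i
    · exact mem_frontier_of_gap (hΦ 0) (x := x 0 - 1) (y := x 0) (by linarith) (Or.inr rfl) (hxP 0)
        fun s hs => hbefore s hs.2
    · exact mem_frontier_of_gap (hΦ j.succ) (hxmono Fin.castSucc_lt_succ) (Or.inr rfl) (hxP _)
        fun s hs => hgapF j s hs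
  -- The index wraps around: after the last crossing comes `Φ 0`, the outer face.
  have hpost : ∀ i, p + x i • d ∈ frontier (Φ (i + 1)) := by
    intro i
    refine Fin.lastCases ?_ (fun j => ?_) i
    · rw [Fin.last_add_one]
      exact mem_frontier_of_gap (hΦ 0) (x := x (Fin.last _)) (y := x (Fin.last _) + 1)
        (by linarith) (Or.inl rfl) (hxP _) fun s hs => hafter s hs.1
    · rw [Fin.coeSucc_eq_succ]
      exact mem_frontier_of_gap (hΦ j.succ) (hxmono Fin.castSucc_lt_succ) (Or.inl rfl) (hxP _)
        fun s hs => hgapF j s hs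
  have hedge := fun i => exists_common_edge hv (hΦ i) (hΦ (i + 1)) (hpre i) (hpost i)
  have hmids : ∀ j : Fin (m + 1), p + ((x j.castSucc + x j.succ) / 2) • d ∈ Φ j.succ := by
    intro j
    have hlt : x j.castSucc < x j.succ := hxmono Fin.castSucc_lt_succ
    exact hgapF j _ ⟨by linarith, by linarith⟩
  -- Were two bounded gaps in the same open triangle, convexity would put the crossing between them
  -- inside it. A bounded gap lies in `T`, so it is not in the outer face either.
  have hτ : Function.Injective τ := by
    have hlt : ∀ i j, i < j → τ i ≠ τ j := by
      intro i j hij he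
      have hF : Φ i = Φ j := (hΦ i).unique hV (he ▸ hΦ j)
      obtain ⟨j, rfl⟩ := Fin.exists_succ_eq.2 (Fin.ne_zero_of_lt hij)
      have hj := hmids j
      have hltj : x j.castSucc < x j.succ := hxmono Fin.castSucc_lt_succ
      rcases Fin.eq_zero_or_eq_succ i with rfl | ⟨i, rfl⟩
      · rw [← hF] at hj
        exact hj (segment_subset_closedTri (hsupT (hxP j.castSucc)) (hsupT (hxP j.succ))
          (mem_segment_line (by linarith) (by linarith)))
      · have hi := hmids i
        have hlti : x i.castSucc < x i.succ := hxmono Fin.castSucc_lt_succ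
        rw [hF] at hi
        have hle : x i.succ ≤ x j.castSucc := hxmono.monotone (by
          rw [Fin.lt_def] at hij
          rw [Fin.le_def]
          simp at hij ⊢
          omega)
        refine Set.disjoint_left.1 (hΦ j.succ).disjoint_support ?_ (hxP i.succ)
        exact (convex_openTri _ _ _).segment_subset hi hj
          (mem_segment_line (by linarith) (by linarith))
    intro i j he
    by_contra hne
    rcases lt_or_gt_of_ne hne with h | h
    exacts [hlt i j h he, hlt j i h he.symm]
  -- With only two faces, both crossings would lie on the unique edge shared by two distinct
  -- triples, which the line meets only once.
  obtain ⟨n, rfl⟩ : ∃ n, m = n + 1 := by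
    refine Nat.exists_eq_succ_of_ne_zero ?_
    rintro rfl
    obtain ⟨u, v, huv, h1, h2, h3, h4, h5⟩ := hedge 0
    obtain ⟨u', v', huv', h1', h2', h3', h4', h5'⟩ := hedge 1
    have hX : (τ 0 ∩ τ 1).ncard ≤ 2 := by
      by_contra hcon
      have e0 : τ 0 ∩ τ 1 = τ 0 := Set.eq_of_subset_of_ncard_le Set.inter_subset_left
        (by rw [(hΦ 0).ncard]; omega)
      have e1 : τ 0 ∩ τ 1 = τ 1 := Set.eq_of_subset_of_ncard_le Set.inter_subset_right
        (by rw [(hΦ 1).ncard]; omega)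
      exact absurd (hτ (e0.symm.trans e1)) (by decide)
    have e : ({u, v} : Set V) = τ 0 ∩ τ 1 := Set.eq_of_subset_of_ncard_le
      (by rintro w (rfl | rfl); exacts [⟨h1, h3⟩, ⟨h2, h4⟩])
      (by rw [Set.ncard_pair huv.ne]; exact hX)
    have e' : ({u', v'} : Set V) = τ 0 ∩ τ 1 := Set.eq_of_subset_of_ncard_le
      (by rintro w (rfl | rfl); exacts [⟨h3', h1'⟩, ⟨h4', h2'⟩])
      (by rw [Set.ncard_pair huv'.ne]; exact hX)
    have hx01 : x 0 = x 1 := by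
      refine line_meets_edge_once hd hv h5 ?_
      rcases Set.pair_eq_pair_iff.1 (e.trans e'.symm) with ⟨rfl, rfl⟩ | ⟨rfl, rfl⟩
      · exact h5'
      · rwa [segment_symm]
    exact absurd (hxmono.injective hx01) (by decide)
  refine ⟨n, τ, hτ, fun i => ⟨_, hΦ i⟩, fun i => ?_, fun s hs => ?_⟩
  · obtain ⟨u, v, huv, h1, h2, h3, h4, -⟩ := hedge i
    exact ⟨u, v, huv, h1, h2, h3, h4⟩
  · by_cases h : x (Fin.last _) < s
    · exact ⟨0, _, hΦ 0, hafter s h⟩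
    have hne : (Finset.univ.filter fun i => s < x i).Nonempty := by
      refine ⟨Fin.last _, Finset.mem_filter.2 ⟨Finset.mem_univ _, lt_of_le_of_ne (not_lt.1 h) ?_⟩⟩
      rintro rfl
      exact hs (hxP _)
    -- The first crossing after `s` tells which gap contains `s`.
    obtain ⟨i, hi, hmin⟩ := Finset.exists_min_image _ id hne
    have hi' := (Finset.mem_filter.1 hi).2
    rcases Fin.eq_zero_or_eq_succ i with rfl | ⟨j, rfl⟩
    · exact ⟨0, _, hΦ 0, hbefore s hi'⟩
    · refine ⟨j.succ, _, hΦ j.succ, hgapF j s ⟨lt_of_le_of_ne ?_ ?_, hi'⟩⟩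
      · by_contra hcon
        have := hmin j.castSucc (Finset.mem_filter.2 ⟨Finset.mem_univ _, not_le.1 hcon⟩)
        exact absurd this (not_le.2 Fin.castSucc_lt_succ)
      · rintro rfl
        exact hs (hxP _)

end StraightLineDrawing

/-! ### From cut sets to cycles in the dual graph. -/

namespace StraightLineDrawing

variable {V : Type*} {G : SimpleGraph V} {π : StraightLineDrawing G}

theorem exists_faceOf [Fintype V] (hG : IsMaximalPlanar G) (hV : 3 < Fintype.card V) {p : Plane}
    (hp : p ∉ π.support) : ∃ t F, π.FaceOf t F ∧ p ∈ F := by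
  obtain ⟨t, F, h, hpF⟩ := π.exists_faceOf_closure hG hV p
  exact ⟨t, F, h, (mem_or_mem_frontier_of_mem_closure hpF).resolve_right
    fun hf => hp (h.frontier_subset_support hf)⟩

theorem IsCutSet.not_mem_support {S : Set Plane} (hS : π.IsCutSet S) {p : Plane} (hp : p ∈ S) :
    p ∉ π.support := by
  obtain ⟨F, ⟨q, -, rfl⟩, hpF⟩ := hS.2.1 p hp
  exact connectedComponentIn_subset _ _ hpF

theorem IsCutSet.finite [Fintype V] (hG : IsMaximalPlanar G) (hV : 3 < Fintype.card V)
    {S : Set Plane} (hS : π.IsCutSet S) : S.Finite := by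
  have h : ∀ p : S, ∃ t F, π.FaceOf t F ∧ (p : Plane) ∈ F :=
    fun p => exists_faceOf hG hV (hS.not_mem_support p.2)
  choose t F hF hpF using h
  have : Finite {F | ∃ t, π.FaceOf t F} := π.finite_faceOf
  refine Set.finite_coe_iff.1 (Finite.of_injective (fun p : S => (⟨F p, t p, hF p⟩ : {F | ∃ t, π.FaceOf t F})) ?_)
  intro p q hpq
  have he : F p = F q := congrArg Subtype.val hpq
  exact Subtype.ext (hS.2.2 (F p) (hF p).mem_faces p p.2 q q.2 (hpF p) (he ▸ hpF q))

/-- A cyclic sequence of faces of one drawing gives a cycle in the dual graph of any other. -/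
theorem le_circumference_dual [Fintype V] (hG : IsMaximalPlanar G) (hV : 3 < Fintype.card V)
    (ρ : StraightLineDrawing G) {n : ℕ} {τ : Fin (n + 3) → Set V} (hτ : Function.Injective τ)
    (hface : ∀ i, ∃ F, π.FaceOf (τ i) F)
    (hedge : ∀ i, ∃ u v, G.Adj u v ∧ u ∈ τ i ∧ v ∈ τ i ∧ u ∈ τ (i + 1) ∧ v ∈ τ (i + 1)) :
    ((n + 3 : ℕ) : ℕ∞) ≤ circumference ρ.dual := by
  -- The vertex triples are kept and the faces of `π` are replaced by those of `ρ` with the same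
  -- triples.
  have hface' : ∀ i, ∃ F, ρ.FaceOf (τ i) F := fun i => (hface i).elim fun _ h => h.transfer hG hV ρ
  choose F hF using hface'
  let φ : Fin (n + 3) → ρ.faces := fun i => ⟨F i, (hF i).mem_faces⟩
  have hφ : Function.Injective φ := by
    intro i j hij
    have he : F i = F j := congrArg Subtype.val hij
    exact hτ ((hF i).eq_of_eq (he ▸ hF j))
  have hstep : ∀ i, ρ.dual.Adj (φ i) (φ (i + 1)) := by
    intro i
    obtain ⟨u, v, huv, h1, h2, h3, h4⟩ := hedge i
    refine ⟨hφ.ne ?_, u, v, huv, (hF i).segment_subset_frontier h1 h2,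
      (hF (i + 1)).segment_subset_frontier h3 h4⟩
    intro h
    have : (1 : Fin (n + 3)) = 0 := by simpa using h.symm
    exact absurd this (by simp)
  let f : SimpleGraph.cycleGraph (n + 3) →g ρ.dual := ⟨φ, by
    intro i j hij
    rcases SimpleGraph.cycleGraph_adj.1 hij with h | h
    · obtain rfl : i = j + 1 := sub_eq_iff_eq_add'.1 h
      exact (hstep j).symm
    · obtain rfl : j = i + 1 := sub_eq_iff_eq_add'.1 h
      exact hstep i⟩
  have hc := (SimpleGraph.cycleGraph.isCycle_cycle (n := n)).map (f := f) hφ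
  have hl : ((SimpleGraph.cycleGraph.cycle n).map f).length = n + 3 := by
    rw [SimpleGraph.Walk.length_map, SimpleGraph.cycleGraph.length_cycle]
  rw [← hl]
  exact le_iSup_of_le (f 0) (le_iSup_of_le _ (le_iSup_of_le hc le_rfl))

/-- A line can be translated by a small amount so that it passes through no vertex. -/
theorem eventually_line_avoids [Finite V] (p : Plane) {d e : Plane}
    (hde : d 0 * e 1 - d 1 * e 0 ≠ 0) :
    ∀ᶠ ε : ℝ in nhdsWithin 0 {0}ᶜ, ∀ w (s : ℝ), π.pos w ≠ p + ε • e + s • d := by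
  rw [Filter.eventually_all]
  intro w
  -- The only shift for which the line can pass through `w`. If it is 0, the punctured neighbourhood
  -- excludes it.
  let r := (d 0 * (π.pos w 1 - p 1) - d 1 * (π.pos w 0 - p 0)) / (d 0 * e 1 - d 1 * e 0)
  have hr : ∀ ε : ℝ, ε ≠ r → ∀ s : ℝ, π.pos w ≠ p + ε • e + s • d := by
    intro ε hε s hs
    refine hε ?_
    simp only [r]
    rw [eq_div_iff hde, hs]
    simp only [PiLp.add_apply, PiLp.smul_apply, smul_eq_mul]; ring
  by_cases h0 : r = 0
  · filter_upwards [self_mem_nhdsWithin] with ε hε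
    exact hr ε (by rw [h0]; exact hε)
  · have : ∀ᶠ ε : ℝ in nhds 0, ε ≠ r := isOpen_ne.eventually_mem (Ne.symm h0)
    filter_upwards [nhdsWithin_le_nhds this] with ε hε
    exact hr ε hε

/-- A small common shift keeps every point of the finite set `S` in its open face and `o` in the
outer triangle, while the line gets clear of the vertices. The faces of `S` then occur at distinct
places of one cyclic sequence. -/
theorem IsCutSet.encard_le_of_inner_point [Fintype V] (hG : IsMaximalPlanar G)
    (hV : 3 < Fintype.card V) (ρ : StraightLineDrawing G) {a b c : V} (hc : π.IsCcwClique a b c)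
    (hout : ∀ w, π.pos w ∈ closedTri (π.pos a) (π.pos b) (π.pos c)) {S : Set Plane}
    (hS : π.IsCutSet S) {o : Plane} (hoS : o ∈ S)
    (ho : o ∈ openTri (π.pos a) (π.pos b) (π.pos c)) : S.encard ≤ circumference ρ.dual := by
  obtain ⟨d, hd, hline⟩ : ∃ d : Plane, d ≠ 0 ∧ ∀ q ∈ S, ∃ r : ℝ, q = o + r • d := by
    obtain ⟨d, hd⟩ := (collinear_iff_of_mem hoS).1 hS.1
    -- This happens only for `S = {o}`, where any direction will do.
    by_cases h0 : d = 0
    · refine ⟨!₂[1, 0], fun h => ?_, fun q hq => ⟨0, ?_⟩⟩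
      · have := congrArg (fun p : Plane => p 0) h
        simp at this
      · obtain ⟨r, rfl⟩ := hd q hq
        simp [h0]
    · refine ⟨d, h0, fun q hq => ?_⟩
      obtain ⟨r, rfl⟩ := hd q hq
      exact ⟨r, by rw [vadd_eq_add, add_comm]⟩
  obtain ⟨e, he⟩ : ∃ e : Plane, d 0 * e 1 - d 1 * e 0 ≠ 0 := by
    refine ⟨!₂[-d 1, d 0], fun h => hd (plane_ext ?_ ?_)⟩ <;>
      simp only [Matrix.cons_val_zero, Matrix.cons_val_one] at h <;>
      simp only [PiLp.zero_apply] <;> nlinarith [sq_nonneg (d 0), sq_nonneg (d 1)]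
  have hfin := hS.finite hG hV
  have h : ∀ q : S, ∃ t F, π.FaceOf t F ∧ (q : Plane) ∈ F :=
    fun q => exists_faceOf hG hV (hS.not_mem_support q.2)
  choose t F hF hqF using h
  have htend : ∀ q : Plane, Filter.Tendsto (fun ε : ℝ => q + ε • e) (nhdsWithin 0 {0}ᶜ)
      (nhds q) := by
    intro q
    have h1 : Continuous fun ε : ℝ => q + ε • e := by fun_prop
    have h2 := h1.tendsto 0
    simp only [zero_smul, add_zero] at h2
    exact h2.mono_left nhdsWithin_le_nhds
  have : Finite S := hfin
  have hev : ∀ᶠ ε : ℝ in nhdsWithin 0 {0}ᶜ, ∀ q : S, (q : Plane) + ε • e ∈ F q :=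
    Filter.eventually_all.2 fun q => (htend q).eventually_mem ((hF q).isOpen.mem_nhds (hqF q))
  obtain ⟨ε, hε1, hε2, hε3⟩ := (hev.and (((htend o).eventually_mem
    ((isOpen_openTri _ _ _).mem_nhds ho)).and (eventually_line_avoids (π := π) o he))).exists
  obtain ⟨n, τ, hτ, hface, hedge, hcov⟩ := exists_cyclic_faces hG hV hc hout hd hε3 (s₀ := 0)
    (by simpa using hε2)
  have hex : ∀ q : S, ∃ i, π.FaceOf (τ i) (F q) := by
    intro q
    obtain ⟨r, hr⟩ := hline q q.2
    have hq : o + ε • e + r • d = (q : Plane) + ε • e := by rw [hr]; module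
    have hmem : o + ε • e + r • d ∈ F q := by rw [hq]; exact hε1 q
    obtain ⟨i, F', hF', hmem'⟩ := hcov r (Set.disjoint_left.1 (hF q).disjoint_support hmem)
    exact ⟨i, by rwa [← (hF q).eq_component hmem, hF'.eq_component hmem']⟩
  choose i hi using hex
  have hinj : Function.Injective i := by
    intro q q' hqq
    have he : F q = F q' := (hi q).unique hV (hqq ▸ hi q')
    exact Subtype.ext (hS.2.2 (F q) (hF q).mem_faces q q.2 q' q'.2 (hqF q) (he ▸ hqF q'))
  refine le_trans ?_ (le_circumference_dual hG hV ρ hτ hface hedge)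
  calc S.encard = ENat.card S := rfl
    _ ≤ ENat.card (Fin (n + 3)) := ENat.card_le_card_of_injective hinj
    _ = ((n + 3 : ℕ) : ℕ∞) := by rw [ENat.card_eq_coe_fintype_card, Fintype.card_fin]

theorem IsCutSet.encard_le [Fintype V] (hG : IsMaximalPlanar G) (hV : 3 < Fintype.card V)
    (ρ : StraightLineDrawing G) {S : Set Plane} (hS : π.IsCutSet S) :
    S.encard ≤ circumference ρ.dual := by
  have : Nontrivial V := Fintype.one_lt_card_iff_nontrivial.1 (by omega)
  obtain ⟨a, b, c, hab, hbc, hca, habc, hout⟩ := π.exists_outer_triangle hG hV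
  have hc : π.IsCcwClique a b c := ⟨hab, hbc, hca, habc⟩
  by_cases hex : ∃ o ∈ S, o ∈ openTri (π.pos a) (π.pos b) (π.pos c)
  · obtain ⟨o, hoS, ho⟩ := hex
    exact hS.encard_le_of_inner_point hG hV ρ hc hout hoS ho
  -- Without a point inside the outer triangle, all of `S` lies in the outer face.
  have hsub : S.Subsingleton := by
    have hface : π.FaceOf {a, b, c} (closedTri (π.pos a) (π.pos b) (π.pos c))ᶜ :=
      ⟨a, b, c, rfl, hc, Or.inr ⟨hout, rfl⟩⟩
    have hmem : ∀ q ∈ S, q ∈ (closedTri (π.pos a) (π.pos b) (π.pos c))ᶜ := by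
      intro q hq hqT
      obtain ⟨u, v, -, -, huv, hs⟩ := hc.exists_side hqT fun h => hex ⟨q, hq, h⟩
      exact hS.not_mem_support hq (π.segment_subset_support huv hs)
    exact fun q hq q' hq' => hS.2.2 _ hface.mem_faces q hq q' hq' (hmem q hq) (hmem q' hq')
  -- A single inner point off the drawing is itself a cut set, which makes the circumference at
  -- least 1.
  obtain ⟨o, ho, hos⟩ : ∃ o ∈ openTri (π.pos a) (π.pos b) (π.pos c), o ∈ π.supportᶜ :=
    π.dense_compl_support.inter_open_nonempty _ (isOpen_openTri _ _ _) (exists_mem_openTri habc)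
  have ho' : π.IsCutSet {o} := by
    refine ⟨collinear_singleton ℝ o, ?_, ?_⟩
    · rintro p rfl
      exact ⟨_, ⟨p, hos, rfl⟩, mem_connectedComponentIn hos⟩
    · rintro F - p rfl q rfl - -
      rfl
  refine (Set.encard_le_one_iff_subsingleton.2 hsub).trans ?_
  rw [← Set.encard_singleton o]
  exact ho'.encard_le_of_inner_point hG hV ρ hc hout rfl ho

end StraightLineDrawing

theorem mainTheorem7 {V : Type*} [Fintype V] (G : SimpleGraph V)
    (hG : IsMaximalPlanar G) (hV : 3 < Fintype.card V) (ρ : StraightLineDrawing G) :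
    cutNumber G ≤ circumference ρ.dual :=
  iSup_le fun _ => iSup_le fun _ => iSup_le fun hS => hS.encard_le hG hV ρ
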